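/- For a positive integer $n$ write $[n]=\{1,\dots,n\}$ (and $[0]=\emptyset$). Let $m,d\ge 0$ be integers, let $\delta\ge 0$ be real, and let $\{u_i\}_{i\in[m]}\subset\mathbb{C}^d$ be a Parseval frame, i.e. $$\sum_{i=1}^m |\langle u,u_i\rangle|^2=\|u\|^2\qquad\text{for all }u\in\mathbb{C}^d,$$ such that $\|u_i\|^2\le\delta$ for all $i\in[m]$ (with the standard inner product and Euclidean norm on $\mathbb{C}^d$). Then for every positive integer $r$ there exists a partition $\{I_1,\dots,I_r\}$ of $[m]$ into $r$ pairwise disjoint, possibly empty, sets such that for each $k=1,\dots,r$ the family $\{u_i\}_{i\in I_k}$ is a Bessel sequence with bound $\left(\frac1{\sqrt r}+\sqrt\delta\right)^2$, i.e. $$\sum_{i\in I_k}|\langle u,u_i\rangle|^2\le\left(\frac1{\sqrt r}+\sqrt\delta\right)^2\|u\|^2\qquad\text{for all }u\in\mathbb{C}^d.$$ -/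

import Mathlib

/-- The family `u` in the inner product space `H` is a Bessel sequence with Bessel bound `B`:
`∑ i, |⟨x, u i⟩|² ≤ B ‖x‖²` for all `x` (in particular the series converges). -/
def IsBesselSequence {H ι : Type*} [NormedAddCommGroup H] [InnerProductSpace ℂ H]
    (u : ι → H) (B : ℝ) : Prop :=
  ∀ x : H, Summable (fun i => ‖inner ℂ (u i) x‖ ^ 2) ∧
    ∑' i, ‖inner ℂ (u i) x‖ ^ 2 ≤ B * ‖x‖ ^ 2

/-- The family `u` is a frame for `H` with lower and upper frame bounds `A` and `B`. -/
def IsFrameWithBounds {H ι : Type*} [NormedAddCommGroup H] [InnerProductSpace ℂ H]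
    (u : ι → H) (A B : ℝ) : Prop :=
  0 < A ∧ A ≤ B ∧ IsBesselSequence u B ∧
    ∀ x : H, A * ‖x‖ ^ 2 ≤ ∑' i, ‖inner ℂ (u i) x‖ ^ 2

/-- A Parseval frame: a frame with both bounds equal to `1`. -/
def IsParsevalFrame {H ι : Type*} [NormedAddCommGroup H] [InnerProductSpace ℂ H]
    (u : ι → H) : Prop :=
  IsFrameWithBounds u 1 1

/-- The sets `I 0, …, I (r - 1)` partition the finite index type `ι`: they are pairwise disjoint
and cover `ι`. Some of them may be empty. -/
def IsIndexPartition {ι : Type*} {r : ℕ} (I : Fin r → Finset ι) : Prop :=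
  (Pairwise fun j k => Disjoint (I j) (I k)) ∧ ∀ i, ∃ k, i ∈ I k

/-! Write `E i = v i (v i)ᴴ`, so that `∑ E i = 1`. With variables `w (i, k)`, `i` a frame index and
`k` a color, put `P(w) = ∏ₖ det (∑ᵢ w (i, k) E i)`, a real stable polynomial. It is affine in each
single variable, because `E i` has rank one. Hence `1 - D_b` with `b = b i k`, the direction `r
e_(i,k)`, acts on `P` as translation by `-b`. Applying these operators for a coloring `σ` and
restricting to the diagonal gives `∏ₖ det (s - r ∑_{σ i = k} E i)`. If this is positive for all `s ≥
T`, then `r ∑_{σ i = k} E i ≤ T` for every color `k`. The goal is `T = (1 + √(rδ))²`.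

The average of `b i k` over `k` is `c i = ∑ₖ e_(i,k)`. Two facts finish the proof. For the averaged
operators `1 - D_{c i}`, a barrier argument shows positivity above `T` (`barrier_step`,
`above_applyOps`). The averages can then be replaced one at a time by some `b i (σ i)` without
losing positivity on the diagonal beyond `T` (`Stable.exists_sub_dirDeriv_pos`).

Both rest on the quotients `D_b p / p` of a stable `p`. Along a nonnegative direction they have
nonpositive imaginary part on the upper half plane; where `p > 0` on the real line they decrease,
and partial fractions give the convexity estimate `tangent_inequality`. -/

section

/-! ### Real rational functions with nonpositive imaginary part on the upper half plane -/

open Polynomial ComplexConjugate Filter Topology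

/-- Some `n`-th root of `I` lies in the open upper half plane. -/
theorem exists_im_pos_pow_eq_I {n : ℕ} (hn : 1 ≤ n) : ∃ η : ℂ, 0 < η.im ∧ η ^ n = Complex.I := by
  have hn' : (1 : ℝ) ≤ n := by exact_mod_cast hn
  refine ⟨Complex.exp ((Real.pi / (2 * n) : ℝ) * Complex.I), ?_, ?_⟩
  · rw [Complex.exp_ofReal_mul_I_im]
    apply Real.sin_pos_of_pos_of_lt_pi (by positivity)
    rw [div_lt_iff₀ (by positivity)]
    nlinarith [Real.pi_pos]
  · have : (n : ℂ) ≠ 0 := by exact_mod_cast (by omega : n ≠ 0)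
    have h : (n : ℂ) * ((Real.pi / (2 * n) : ℝ) * Complex.I) = Real.pi / 2 * Complex.I := by
      push_cast
      field_simp
    rw [← Complex.exp_nat_mul, h, Complex.exp_pi_div_two_mul_I]

/-- For `n ≥ 2` some `n`-th root of `-I` lies in the open upper half plane. -/
theorem exists_im_pos_pow_eq_neg_I {n : ℕ} (hn : 2 ≤ n) :
    ∃ η : ℂ, 0 < η.im ∧ η ^ n = -Complex.I := by
  have hn' : (2 : ℝ) ≤ n := by exact_mod_cast hn
  refine ⟨Complex.exp ((3 * Real.pi / (2 * n) : ℝ) * Complex.I), ?_, ?_⟩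
  · rw [Complex.exp_ofReal_mul_I_im]
    apply Real.sin_pos_of_pos_of_lt_pi (by positivity)
    rw [div_lt_iff₀ (by positivity)]
    nlinarith [Real.pi_pos]
  · have : (n : ℂ) ≠ 0 := by exact_mod_cast (by omega : n ≠ 0)
    rw [← Complex.exp_nat_mul]
    have h : (n : ℂ) * ((3 * Real.pi / (2 * n) : ℝ) * Complex.I)
        = Real.pi * Complex.I + Real.pi / 2 * Complex.I := by
      push_cast
      field_simp
      ring
    rw [h, Complex.exp_add, Complex.exp_pi_mul_I, Complex.exp_pi_div_two_mul_I]
    ring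

/-- A nonzero polynomial whose logarithmic derivative has nonpositive imaginary part on the upper
half plane has no zeros there. -/
theorem aeval_ne_zero_of_im_derivative_mul_conj_nonpos {F : ℝ[X]} (hF : F ≠ 0)
    (h : ∀ z : ℂ, 0 < z.im → (aeval z (derivative F) * conj (aeval z F)).im ≤ 0)
    {z : ℂ} (hz : 0 < z.im) : aeval z F ≠ 0 := by
  intro h0
  set f : ℂ[X] := F.map (algebraMap ℝ ℂ) with hf
  have hf0 : f ≠ 0 := by
    rwa [hf, Ne, Polynomial.map_eq_zero]
  have hroot : f.IsRoot z := by
    rw [IsRoot, hf, eval_map_algebraMap, h0]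
  obtain ⟨q, hq, hnd⟩ := exists_eq_pow_rootMultiplicity_mul_and_not_dvd f hf0 z
  have hk : 0 < rootMultiplicity z f := (rootMultiplicity_pos hf0).2 hroot
  obtain ⟨j, hj⟩ : ∃ j, rootMultiplicity z f = j + 1 := ⟨_, (Nat.succ_pred_eq_of_pos hk).symm⟩
  rw [hj] at hq
  have hqz : eval z q ≠ 0 := fun h => hnd (dvd_iff_isRoot.2 h)
  have hd : derivative f = (X - C z) ^ j * (((j : ℂ[X]) + 1) * q + (X - C z) * derivative q) := by
    rw [hq, derivative_mul, derivative_X_sub_C_pow]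
    simp only [Nat.add_sub_cancel, Nat.cast_add, Nat.cast_one, map_add, map_natCast, map_one]
    ring
  -- Near a zero `z` of order `j + 1`, `f' / f` behaves like `(j + 1) / (w - z)`, whose imaginary
  -- part is positive directly below `z`. For `s > 0`, `φ s` is `Im (f' conj f)` at `z - s I`
  -- divided by `s ^ (2 * j + 1)`; its value at `0` is `(j + 1) |q z|² > 0`.
  let φ : ℝ → ℝ := fun s => (Complex.I * ((((j : ℂ) + 1) * eval (z - s * Complex.I) q +
    (-(s * Complex.I)) * eval (z - s * Complex.I) (derivative q)) *
      conj (eval (z - s * Complex.I) q))).im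
  have hφ : Continuous φ := by
    apply Complex.continuous_im.comp
    have h1 : Continuous fun s : ℝ => z - s * Complex.I := by fun_prop
    have h2 := q.continuous.comp h1
    have h3 := (derivative q).continuous.comp h1
    have h4 := Complex.continuous_conj.comp h2
    simp only [Function.comp_def] at h2 h3 h4
    fun_prop
  have hφ0 : 0 < φ 0 := by
    simp only [φ, Complex.ofReal_zero, zero_mul, sub_zero, neg_zero, add_zero, mul_assoc,
      Complex.mul_conj]
    have : 0 < Complex.normSq (eval z q) := Complex.normSq_pos.2 hqz
    norm_cast
    rw [Complex.I_mul_im, Complex.ofReal_re]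
    positivity
  have hev : ∀ᶠ s in 𝓝[>] (0 : ℝ), φ s ≤ 0 := by
    have hlt : ∀ᶠ s in 𝓝[>] (0 : ℝ), s < z.im := nhdsWithin_le_nhds (Iio_mem_nhds hz)
    filter_upwards [hlt, self_mem_nhdsWithin] with s hs hs0
    have hs0 : 0 < s := hs0
    have hzs : 0 < (z - s * Complex.I).im := by simpa using hs
    have key := h _ hzs
    rw [← eval_map_algebraMap, ← eval_map_algebraMap, ← derivative_map, ← hf, hd] at key
    conv at key =>
      lhs; arg 1; arg 2; rw [hq]
    simp only [eval_mul, eval_pow, eval_sub, eval_X, eval_C, eval_add, eval_natCast, eval_one,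
      map_mul, map_pow, sub_sub_cancel_left] at key
    have e : (-(s * Complex.I)) ^ j * (((j : ℂ) + 1) * eval (z - s * Complex.I) q +
        -(s * Complex.I) * eval (z - s * Complex.I) (derivative q)) *
        (conj (-(s * Complex.I)) ^ (j + 1) * conj (eval (z - s * Complex.I) q)) =
        ((s ^ (2 * j + 1) : ℝ) : ℂ) * (Complex.I * ((((j : ℂ) + 1) * eval (z - s * Complex.I) q +
        (-(s * Complex.I)) * eval (z - s * Complex.I) (derivative q)) *
        conj (eval (z - s * Complex.I) q))) := by
      have : (-(s * Complex.I)) ^ j * conj (-(s * Complex.I)) ^ (j + 1)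
          = ((s ^ (2 * j + 1) : ℝ) : ℂ) * Complex.I := by
        rw [pow_succ, ← mul_assoc, ← mul_pow]
        have : -((s : ℂ) * Complex.I) * conj (-((s : ℂ) * Complex.I)) = s ^ 2 := by
          simp only [map_neg, map_mul, Complex.conj_ofReal, Complex.conj_I]
          ring_nf
          simp
        rw [this]
        simp only [map_neg, map_mul, Complex.conj_ofReal, Complex.conj_I]
        push_cast
        ring
      linear_combination (((j : ℂ) + 1) * eval (z - s * Complex.I) q +
        -(s * Complex.I) * eval (z - s * Complex.I) (derivative q)) *
         conj (eval (z - s * Complex.I) q) * this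
    rw [e, Complex.im_ofReal_mul] at key
    have : 0 < s ^ (2 * j + 1) := by positivity
    exact nonpos_of_mul_nonpos_right key this
  have hlim : Tendsto φ (𝓝[>] 0) (𝓝 (φ 0)) := hφ.continuousAt.mono_left nhdsWithin_le_nhds
  exact absurd (le_of_tendsto hlim hev) (not_le.2 hφ0)

theorem aeval_ofReal_complex (F : ℝ[X]) (t : ℝ) : aeval (t : ℂ) F = ((eval t F : ℝ) : ℂ) := by
  have := aeval_algebraMap_apply ℂ t F
  simpa using this

/-- If `G / F` has nonpositive imaginary part on the upper half plane, then the Wronskian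
`G' F - G F'` is nonpositive on the real line. -/
theorem wronskian_nonpos {F G : ℝ[X]}
    (h : ∀ z : ℂ, 0 < z.im → (aeval z G * conj (aeval z F)).im ≤ 0) (t : ℝ) :
    eval t (derivative G) * eval t F - eval t G * eval t (derivative F) ≤ 0 := by
  -- `Im (G conj F)` vanishes on the real line and is nonpositive above it, so its derivative along
  -- `t + s I` at `s = 0` is nonpositive; this derivative is the Wronskian.
  have hline : HasDerivAt (fun s : ℝ => (t : ℂ) + s * Complex.I) Complex.I 0 := by
    simpa using (Complex.ofRealCLM.hasDerivAt (x := (0 : ℝ))).mul_const Complex.I |>.const_add (t : ℂ)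
  have hp : ∀ P : ℝ[X], HasDerivAt (fun s : ℝ => aeval ((t : ℂ) + s * Complex.I) P)
      (((eval t (derivative P) : ℝ) : ℂ) * Complex.I) 0 := by
    intro P
    have h1 := (P.map (algebraMap ℝ ℂ)).hasDerivAt ((t : ℂ) + (0 : ℝ) * Complex.I)
    have h2 := h1.comp (0 : ℝ) hline
    rw [derivative_map, eval_map_algebraMap] at h2
    simp only [Complex.ofReal_zero, zero_mul, add_zero, aeval_ofReal_complex] at h2
    refine h2.congr_of_eventuallyEq (Eventually.of_forall fun s => ?_)
    simp [eval_map_algebraMap]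
  have hprod := (hp G).mul (hp F).star
  have him := Complex.imCLM.hasFDerivAt.comp_hasDerivAt (0 : ℝ) hprod
  have hval : (((eval t (derivative G) : ℝ) : ℂ) * Complex.I *
        conj (aeval ((t : ℂ) + (0 : ℝ) * Complex.I) F) +
      aeval ((t : ℂ) + (0 : ℝ) * Complex.I) G *
        conj (((eval t (derivative F) : ℝ) : ℂ) * Complex.I)).im
      = eval t (derivative G) * eval t F - eval t G * eval t (derivative F) := by
    simp only [Complex.ofReal_zero, zero_mul, add_zero, aeval_ofReal_complex, map_mul,
      Complex.conj_ofReal, Complex.conj_I]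
    simp
    ring
  have hφ0 : (aeval ((t : ℂ) + (0 : ℝ) * Complex.I) G *
      conj (aeval ((t : ℂ) + (0 : ℝ) * Complex.I) F)).im = 0 := by
    simp only [Complex.ofReal_zero, zero_mul, add_zero, aeval_ofReal_complex, Complex.conj_ofReal]
    simp
  have hs := him.tendsto_slope_zero_right
  rw [← hval]
  refine le_of_tendsto hs ?_
  filter_upwards [self_mem_nhdsWithin] with s hs
  have hs : 0 < s := hs
  have key := h ((t : ℂ) + s * Complex.I) (by simpa using hs)
  simp only [Function.comp_apply, Pi.mul_apply, Complex.imCLM_apply, zero_add, smul_eq_mul]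
  have : (aeval ((t : ℂ) + (0 : ℝ) * Complex.I) G *
      star (aeval ((t : ℂ) + (0 : ℝ) * Complex.I) F)).im = 0 := hφ0
  rw [this, sub_zero]
  exact mul_nonpos_of_nonneg_of_nonpos (by positivity) key

/-- At a real zero of `F` where `G` does not vanish, the zero is simple if `G / F` has
nonpositive imaginary part on the upper half plane. -/
theorem simple_root_of_im_nonpos {F G : ℝ[X]} (hF0 : F ≠ 0)
    (h : ∀ z : ℂ, 0 < z.im → (aeval z G * conj (aeval z F)).im ≤ 0) {y : ℝ}
    (hy : F.IsRoot y) (hG : eval y G ≠ 0) : eval y (derivative F) ≠ 0 := by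
  obtain ⟨q, hq, hnd⟩ := exists_eq_pow_rootMultiplicity_mul_and_not_dvd F hF0 y
  have hk : 0 < rootMultiplicity y F := (rootMultiplicity_pos hF0).2 hy
  set k := rootMultiplicity y F with hkdef
  have hqy : eval y q ≠ 0 := fun h => hnd (dvd_iff_isRoot.2 h)
  -- On the ray `y + s η` one has `F = s ^ k η ^ k q`; dividing by `s ^ k` and letting `s → 0`
  -- leaves this leading coefficient.
  have hlim : ∀ η : ℂ, 0 < η.im → ((eval y G * eval y q : ℝ) * conj (η ^ k)).im ≤ 0 := by
    intro η hη
    let φ : ℝ → ℝ := fun s => (aeval ((y : ℂ) + s * η) G * conj (aeval ((y : ℂ) + s * η) q) *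
      conj (η ^ k)).im
    have hφ : Continuous φ := by
      apply Complex.continuous_im.comp
      have h1 : Continuous fun s : ℝ => (y : ℂ) + s * η := by fun_prop
      have h2 := (Polynomial.continuous_aeval (A := ℂ) G).comp h1
      have h3 := Complex.continuous_conj.comp ((Polynomial.continuous_aeval (A := ℂ) q).comp h1)
      simp only [Function.comp_def] at h2 h3
      fun_prop
    have h0 : φ 0 = ((eval y G * eval y q : ℝ) * conj (η ^ k)).im := by
      simp only [φ, Complex.ofReal_zero, zero_mul, add_zero, aeval_ofReal_complex,
        Complex.conj_ofReal]
      push_cast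
      rfl
    rw [← h0]
    refine le_of_tendsto (hφ.continuousAt.mono_left nhdsWithin_le_nhds : Tendsto φ (𝓝[>] 0) _) ?_
    filter_upwards [self_mem_nhdsWithin] with s hs
    have hs : 0 < s := hs
    have key := h ((y : ℂ) + s * η) (by simpa using mul_pos hs hη)
    rw [hq] at key
    simp only [map_mul, map_pow, map_sub, aeval_X, aeval_C, Complex.coe_algebraMap,
      add_sub_cancel_left, mul_pow, Complex.conj_ofReal] at key
    have e : aeval ((y : ℂ) + s * η) G * ((s : ℂ) ^ k * conj η ^ k *
        conj (aeval ((y : ℂ) + s * η) q)) = ((s ^ k : ℝ) : ℂ) *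
        (aeval ((y : ℂ) + s * η) G * conj (aeval ((y : ℂ) + s * η) q) * conj (η ^ k)) := by
      rw [map_pow]; push_cast; ring
    rw [e, Complex.im_ofReal_mul] at key
    exact nonpos_of_mul_nonpos_right key (by positivity)
  have hne : eval y G * eval y q ≠ 0 := mul_ne_zero hG hqy
  obtain ⟨η, hη, hηk⟩ := exists_im_pos_pow_eq_I hk
  have h1 := hlim η hη
  rw [hηk, Complex.conj_I, Complex.im_ofReal_mul] at h1
  -- For `k ≥ 2` both `I` and `-I` are `k`-th powers of points of the upper half plane, which would
  -- force the nonzero number `G(y) q(y)` to have both signs.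
  have hk1 : k = 1 := by
    by_contra hk1
    obtain ⟨η', hη', hηk'⟩ := exists_im_pos_pow_eq_neg_I (n := k) (by omega)
    have h2 := hlim η' hη'
    rw [hηk', map_neg, Complex.conj_I, Complex.im_ofReal_mul] at h2
    simp at h1 h2
    exact hne (le_antisymm (by simpa using h2) (by simpa using h1))
  rw [hk1, pow_one] at hq
  rw [hq]
  simpa using hqy

/-- Partial fraction expansion: a polynomial `G` is, modulo a split polynomial `F` with simple
roots, a combination of the quotients of `F` by its linear factors. -/
theorem exists_partial_fractions {F : ℝ[X]} (hsplit : F.Splits) (hF0 : F ≠ 0)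
    (hsimple : ∀ y, F.IsRoot y → eval y (derivative F) ≠ 0) (G : ℝ[X]) :
    G = (G / F) * F + ∑ y ∈ F.roots.toFinset,
      C (eval y G / eval y (derivative F)) * (F /ₘ (X - C y)) := by
  have hdiv : ∀ y ∈ F.roots.toFinset, (X - C y) * (F /ₘ (X - C y)) = F := by
    intro y hy
    rw [Multiset.mem_toFinset, mem_roots hF0] at hy
    exact mul_divByMonic_eq_iff_isRoot.2 hy
  have hev : ∀ y ∈ F.roots.toFinset, eval y (F /ₘ (X - C y)) = eval y (derivative F) := by
    intro y hy
    conv_rhs => rw [← hdiv y hy]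
    simp
  have hev' : ∀ y ∈ F.roots.toFinset, ∀ x ∈ F.roots.toFinset, x ≠ y →
      eval x (F /ₘ (X - C y)) = 0 := by
    intro y hy x hx hxy
    have h1 := congrArg (eval x) (hdiv y hy)
    rw [Multiset.mem_toFinset, mem_roots hF0, IsRoot] at hx
    rw [hx] at h1
    simp only [eval_mul, eval_sub, eval_X, eval_C, mul_eq_zero, sub_eq_zero] at h1
    exact h1.resolve_left hxy
  have hnodup : F.roots.Nodup := by
    rw [Multiset.nodup_iff_count_le_one]
    intro y
    rw [count_roots]
    by_contra hlt
    push Not at hlt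
    have := (one_lt_rootMultiplicity_iff_isRoot hF0).1 hlt
    exact hsimple y this.1 this.2
  have hcard : (F.roots.toFinset.card : WithBot ℕ) = F.degree := by
    rw [Multiset.toFinset_card_of_nodup hnodup, hsplit.degree_eq_card_roots hF0]
  -- Lagrange interpolation: both sides have degree below the number of roots of `F` and agree at
  -- each root.
  have hrem : G % F = ∑ y ∈ F.roots.toFinset,
      C (eval y G / eval y (derivative F)) * (F /ₘ (X - C y)) := by
    apply eq_of_degrees_lt_of_eval_finset_eq F.roots.toFinset
    · rw [hcard]; exact EuclideanDomain.mod_lt G hF0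
    · rw [hcard]
      refine (degree_sum_le _ _).trans_lt ?_
      rw [Finset.sup_lt_iff (bot_lt_iff_ne_bot.2 (by rwa [Ne, degree_eq_bot]))]
      intro y hy
      rw [← smul_eq_C_mul]
      refine (degree_smul_le _ _).trans_lt ?_
      refine degree_divByMonic_lt _ _ hF0 ?_
      rw [degree_X_sub_C]
      exact zero_lt_one
    · intro x hx
      have h1 : eval x (G % F) = eval x G := by
        rw [EuclideanDomain.mod_eq_sub_mul_div]
        have : eval x F = 0 := by rwa [Multiset.mem_toFinset, mem_roots hF0] at hx
        simp [this]
      rw [h1, eval_finsetSum, Finset.sum_eq_single x]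
      · rw [eval_mul, eval_C, hev x hx, div_mul_cancel₀]
        rw [Multiset.mem_toFinset, mem_roots hF0] at hx
        exact hsimple x hx
      · intro y hy hyx
        rw [eval_mul, hev' y hy x hx hyx.symm, mul_zero]
      · exact fun h => absurd hx h
  rw [← hrem, mul_comm]
  exact (EuclideanDomain.div_add_mod G F).symm

/-- A real polynomial with nonpositive imaginary part on the upper half plane, up to an error
vanishing at infinity, is affine. -/
theorem natDegree_le_one_of_im_add_nonpos {Q : ℝ[X]} {E : ℂ → ℂ}
    (hE : ∀ η : ℂ, 0 < η.im → Tendsto (fun s : ℝ => E (s * η)) atTop (𝓝 0))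
    (h : ∀ z : ℂ, 0 < z.im → (aeval z Q + E z).im ≤ 0) : Q.natDegree ≤ 1 := by
  by_contra hn
  push Not at hn
  set n := Q.natDegree with hndef
  -- Along the ray `s η`, dividing by `s ^ n` isolates the leading term; `Q.reverse` at `(s η)⁻¹`
  -- expresses this rescaling. Taking `η ^ n = ± I` then gives the leading coefficient both signs.
  have hlim : ∀ η : ℂ, 0 < η.im → Q.leadingCoeff * (η ^ n).im ≤ 0 := by
    intro η hη
    have hη0 : η ≠ 0 := by rintro rfl; simp at hη
    have hinv : Tendsto (fun s : ℝ => ((s : ℂ) * η)⁻¹) atTop (𝓝 0) := by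
      have h1 : Tendsto (fun s : ℝ => ((s⁻¹ : ℝ) : ℂ) * η⁻¹) atTop (𝓝 (((0 : ℝ) : ℂ) * η⁻¹)) :=
        ((Complex.continuous_ofReal.tendsto 0).comp tendsto_inv_atTop_zero).mul_const _
      simp only [Complex.ofReal_zero, zero_mul] at h1
      refine h1.congr fun s => ?_
      rw [mul_inv, Complex.ofReal_inv]
    have hpow : Tendsto (fun s : ℝ => (((s⁻¹) ^ n : ℝ) : ℂ)) atTop (𝓝 0) := by
      have h1 : Tendsto (fun s : ℝ => (s⁻¹) ^ n) atTop (𝓝 (0 ^ n)) :=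
        tendsto_inv_atTop_zero.pow n
      rw [zero_pow (by omega)] at h1
      exact (Complex.continuous_ofReal.tendsto 0).comp h1
    have hrev : Tendsto (fun s : ℝ => η ^ n * aeval (((s : ℂ) * η)⁻¹) Q.reverse +
        (((s⁻¹) ^ n : ℝ) : ℂ) * E (s * η)) atTop (𝓝 (η ^ n * Q.leadingCoeff + 0 * 0)) := by
      refine (Tendsto.const_mul _ ?_).add (hpow.mul (hE η hη))
      have h2 := ((Polynomial.continuous_aeval (A := ℂ) Q.reverse).tendsto 0).comp hinv
      have h3 : aeval (0 : ℂ) Q.reverse = (Q.leadingCoeff : ℂ) := by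
        rw [← coeff_zero_reverse, ← coeff_zero_eq_aeval_zero']
        rfl
      rwa [h3] at h2
    have hev : ∀ᶠ s : ℝ in atTop, (η ^ n * aeval (((s : ℂ) * η)⁻¹) Q.reverse +
        (((s⁻¹) ^ n : ℝ) : ℂ) * E (s * η)).im ≤ 0 := by
      filter_upwards [eventually_gt_atTop 0] with s hs
      have key := h (s * η) (by simpa using mul_pos hs hη)
      have hs0 : (s : ℂ) ≠ 0 := by exact_mod_cast hs.ne'
      let _ : Invertible ((s : ℂ) * η) := invertibleOfNonzero (mul_ne_zero hs0 hη0)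
      have e := eval₂_reverse_mul_pow (algebraMap ℝ ℂ) ((s : ℂ) * η) Q
      rw [invOf_eq_inv, ← aeval_def, ← aeval_def, ← hndef] at e
      have e2 : η ^ n * aeval (((s : ℂ) * η)⁻¹) Q.reverse + (((s⁻¹) ^ n : ℝ) : ℂ) * E (s * η)
          = (((s⁻¹) ^ n : ℝ) : ℂ) * (aeval ((s : ℂ) * η) Q + E (s * η)) := by
        rw [← e]
        have hsn : (((s⁻¹) ^ n : ℝ) : ℂ) * (s : ℂ) ^ n = 1 := by
          push_cast
          rw [← mul_pow, inv_mul_cancel₀ hs0, one_pow]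
        rw [mul_pow]
        linear_combination (-(aeval (((s : ℂ) * η)⁻¹) Q.reverse * η ^ n)) * hsn
      rw [e2, Complex.im_ofReal_mul]
      exact mul_nonpos_of_nonneg_of_nonpos (by positivity) key
    have := le_of_tendsto ((Complex.continuous_im.tendsto _).comp hrev) hev
    simp only [mul_zero, add_zero, mul_comm (η ^ n), Complex.im_ofReal_mul] at this
    exact this
  have hQ : Q.leadingCoeff ≠ 0 := by
    rw [Ne, leadingCoeff_eq_zero]
    rintro rfl
    simp [hndef] at hn
  obtain ⟨η, hη, hηn⟩ := exists_im_pos_pow_eq_I (n := n) (by omega)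
  obtain ⟨η', hη', hηn'⟩ := exists_im_pos_pow_eq_neg_I (n := n) (by omega)
  have h1 := hlim η hη
  have h2 := hlim η' hη'
  rw [hηn] at h1
  rw [hηn'] at h2
  simp only [Complex.I_im, mul_one, Complex.neg_im, mul_neg] at h1 h2
  exact hQ (le_antisymm h1 (by linarith))

/-- Tangent line inequality at `t` for `G / F`, for coprime `F` and `G`. -/
theorem tangent_inequality_of_coprime {F G : ℝ[X]} (hco : IsCoprime F G)
    (hF : ∀ z : ℂ, 0 < z.im → aeval z F ≠ 0) (hpos : ∀ t, 0 ≤ t → eval t F ≠ 0)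
    (h : ∀ z : ℂ, 0 < z.im → (aeval z G * conj (aeval z F)).im ≤ 0) {t : ℝ} (ht : 0 ≤ t) :
    eval t G / eval t F - t * ((eval t (derivative G) * eval t F -
      eval t G * eval t (derivative F)) / eval t F ^ 2) ≤ eval 0 G / eval 0 F := by
  have hF0 : F ≠ 0 := by
    rintro rfl
    exact hpos 0 le_rfl eval_zero
  have hG : ∀ y, F.IsRoot y → eval y G ≠ 0 := by
    intro y hy h0
    obtain ⟨a, b, hab⟩ := hco
    have := congrArg (eval y) hab
    rw [IsRoot] at hy
    simp [hy, h0] at this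
  have hsimple : ∀ y, F.IsRoot y → eval y (derivative F) ≠ 0 := fun y hy =>
    simple_root_of_im_nonpos hF0 h hy (hG y hy)
  have hsplit : F.Splits := by
    refine Splits.of_splits_map (algebraMap ℝ ℂ) (IsAlgClosed.splits _) fun a ha => ?_
    have hroot : aeval a F = 0 := by
      rw [← eval_map_algebraMap]
      exact (mem_roots'.1 ha).2
    have him : a.im = 0 := by
      rcases lt_trichotomy a.im 0 with hlt | h0 | hgt
      · have h1 : aeval (conj a) F = 0 := by
          have h2 := aeval_algHom_apply (Complex.conjAe : ℂ →ₐ[ℝ] ℂ) a F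
          rw [hroot, map_zero] at h2
          exact h2
        exact absurd h1 (hF _ (by simpa using hlt))
      · exact h0
      · exact absurd hroot (hF a hgt)
    exact ⟨a.re, Complex.ext (by simp) (by simp [him])⟩
  set S := F.roots.toFinset with hS
  set Q := G / F with hQ
  set c : ℝ → ℝ := fun y => eval y G / eval y (derivative F) with hc
  have hpf : G = Q * F + ∑ y ∈ S, C (c y) * (F /ₘ (X - C y)) :=
    exists_partial_fractions hsplit hF0 hsimple G
  have hroot : ∀ y ∈ S, F.IsRoot y := fun y hy => by
    rwa [hS, Multiset.mem_toFinset, mem_roots hF0] at hy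
  have hdiv : ∀ y ∈ S, (X - C y) * (F /ₘ (X - C y)) = F := fun y hy =>
    mul_divByMonic_eq_iff_isRoot.2 (hroot y hy)
  -- At a root of `F` the Wronskian reduces to `-G F'`, so the residue `G / F'` is nonnegative.
  have hc0 : ∀ y ∈ S, 0 ≤ c y := by
    intro y hy
    have h1 := wronskian_nonpos h y
    have h2 : eval y F = 0 := hroot y hy
    rw [h2, mul_zero, zero_sub] at h1
    rw [hc]
    simp only
    rcases le_or_gt 0 (eval y (derivative F)) with h3 | h3
    · have h3 := lt_of_le_of_ne h3 (hsimple y (hroot y hy)).symm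
      exact div_nonneg (nonneg_of_mul_nonneg_left (by linarith) h3) h3.le
    · exact div_nonneg_of_nonpos (by nlinarith) h3.le
  have hneg : ∀ y ∈ S, y < 0 := by
    intro y hy
    by_contra hy0
    exact hpos y (not_lt.1 hy0) (hroot y hy)
  have hcx : ∀ z : ℂ, aeval z F ≠ 0 →
      aeval z G = aeval z F * (aeval z Q + ∑ y ∈ S, (c y : ℂ) * (z - y)⁻¹) := by
    intro z hz
    have h1 := congrArg (aeval z) hpf
    rw [h1, map_add, map_mul, map_sum, mul_add, mul_comm (aeval z F), Finset.mul_sum]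
    congr 1
    refine Finset.sum_congr rfl fun y hy => ?_
    have h2 := congrArg (aeval z) (hdiv y hy)
    simp only [map_mul, map_sub, aeval_X, aeval_C, Complex.coe_algebraMap] at h2 ⊢
    have h3 : z - y ≠ 0 := by
      intro h3
      rw [h3, zero_mul] at h2
      exact hz h2.symm
    rw [← h2]
    field_simp
  have hre : ∀ x : ℝ, eval x F ≠ 0 →
      eval x G / eval x F = eval x Q + ∑ y ∈ S, c y * (x - y)⁻¹ := by
    intro x hx
    have h1 := hcx x (by rw [aeval_ofReal_complex]; exact_mod_cast hx)
    simp only [aeval_ofReal_complex] at h1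
    rw [div_eq_iff hx, mul_comm]
    exact_mod_cast h1
  have hdeg : Q.natDegree ≤ 1 := by
    refine natDegree_le_one_of_im_add_nonpos (E := fun z => ∑ y ∈ S, (c y : ℂ) * (z - y)⁻¹)
      (fun η hη => ?_) (fun z hz => ?_)
    · have : (0 : ℂ) = ∑ y ∈ S, (c y : ℂ) * 0 := by simp
      rw [this]
      refine tendsto_finsetSum _ fun y _ => Tendsto.const_mul _ ?_
      apply tendsto_inv₀_cobounded.comp
      apply tendsto_norm_atTop_iff_cobounded.1
      have h1 : Tendsto (fun s : ℝ => s * ‖η‖ - ‖(y : ℂ)‖) atTop atTop := by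
        apply tendsto_atTop_add_const_right
        exact tendsto_id.atTop_mul_const (norm_pos_iff.2 (by rintro rfl; simp at hη))
      refine tendsto_atTop_mono' _ ?_ h1
      filter_upwards [eventually_ge_atTop 0] with s hs
      have := norm_sub_norm_le ((s : ℂ) * η) y
      rwa [norm_mul, Complex.norm_real, Real.norm_of_nonneg hs] at this
    · have h1 := h z hz
      rw [hcx z (hF z hz), mul_right_comm, Complex.mul_conj, Complex.im_ofReal_mul] at h1
      exact nonpos_of_mul_nonpos_right h1 (Complex.normSq_pos.2 (hF z hz))
  have hderiv : (eval t (derivative G) * eval t F - eval t G * eval t (derivative F)) /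
      eval t F ^ 2 = Q.coeff 1 + ∑ y ∈ S, c y * (-1 / (t - y) ^ 2) := by
    have h1 : HasDerivAt (fun x => eval x G / eval x F) _ t :=
      (G.hasDerivAt t).div (F.hasDerivAt t) (hpos t ht)
    have h2 : HasDerivAt (fun x => eval x Q + ∑ y ∈ S, c y * (x - y)⁻¹)
        (eval t (derivative Q) + ∑ y ∈ S, c y * (-1 / (t - y) ^ 2)) t := by
      refine (Q.hasDerivAt t).add (HasDerivAt.fun_sum fun y hy => HasDerivAt.const_mul _ ?_)
      exact ((hasDerivAt_id t).sub_const y).fun_inv (by linarith [hneg y hy] : 0 < t - y).ne'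
    have hev : (fun x => eval x G / eval x F) =ᶠ[𝓝 t]
        (fun x => eval x Q + ∑ y ∈ S, c y * (x - y)⁻¹) := by
      filter_upwards [F.continuous.continuousAt.eventually_ne (hpos t ht)] with x hx
      exact hre x hx
    rw [h1.unique (h2.congr_of_eventuallyEq hev), eq_X_add_C_of_natDegree_le_one hdeg]
    simp
  rw [hderiv, hre t (hpos t ht), hre 0 (hpos 0 le_rfl), eq_X_add_C_of_natDegree_le_one hdeg]
  simp only [eval_add, eval_mul, eval_C, eval_X, coeff_add, coeff_C_mul, coeff_X_one, coeff_C_succ,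
    mul_one, mul_zero, add_zero, zero_add]
  -- The affine part `Q` gives equality. Each `1 / (x - y)` with `y < 0` is convex on `[0, ∞)`, with
  -- tangent gap `t² / ((-y) (t - y)²)`.
  have hterm : ∑ y ∈ S, c y * (t - y)⁻¹ - t * ∑ y ∈ S, c y * (-1 / (t - y) ^ 2) ≤
      ∑ y ∈ S, c y * (0 - y)⁻¹ := by
    rw [Finset.mul_sum, ← Finset.sum_sub_distrib]
    refine Finset.sum_le_sum fun y hy => ?_
    have hy0 := hneg y hy
    have h1 : 0 < t - y := by linarith
    have h2 : 0 < 0 - y := by linarith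
    have h3 : (t - y)⁻¹ - t * (-1 / (t - y) ^ 2) ≤ (0 - y)⁻¹ := by
      rw [← sub_nonneg]
      have : (0 - y)⁻¹ - ((t - y)⁻¹ - t * (-1 / (t - y) ^ 2))
          = t ^ 2 / ((0 - y) * (t - y) ^ 2) := by
        field_simp
        ring
      rw [this]
      positivity
    calc _ = c y * ((t - y)⁻¹ - t * (-1 / (t - y) ^ 2)) := by ring
      _ ≤ _ := mul_le_mul_of_nonneg_left h3 (hc0 y hy)
  linarith

/-- Tangent line inequality at `t` for a rational function `G / F` with nonpositive imaginary part
on the upper half plane and without poles on `[0, ∞)`. -/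
theorem tangent_inequality {F G : ℝ[X]}
    (hF : ∀ z : ℂ, 0 < z.im → aeval z F ≠ 0) (hpos : ∀ t, 0 ≤ t → eval t F ≠ 0)
    (h : ∀ z : ℂ, 0 < z.im → (aeval z G * conj (aeval z F)).im ≤ 0) {t : ℝ} (ht : 0 ≤ t) :
    eval t G / eval t F - t * ((eval t (derivative G) * eval t F -
      eval t G * eval t (derivative F)) / eval t F ^ 2) ≤ eval 0 G / eval 0 F := by
  have hF0 : F ≠ 0 := by
    rintro rfl
    exact hpos 0 le_rfl eval_zero
  -- Cancelling the common factor `k` divides `G conj F` by `|k|² > 0`, so the sign hypothesis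
  -- survives.
  obtain ⟨F₁, G₁, k, hco, hFk, hGk⟩ : ∃ F₁ G₁ k : ℝ[X], IsCoprime F₁ G₁ ∧
      F = k * F₁ ∧ G = k * G₁ := by
    classical
    obtain ⟨F₁, hF₁⟩ := EuclideanDomain.gcd_dvd_left F G
    obtain ⟨G₁, hG₁⟩ := EuclideanDomain.gcd_dvd_right F G
    refine ⟨F₁, G₁, _, ⟨EuclideanDomain.gcdA F G, EuclideanDomain.gcdB F G, ?_⟩, hF₁, hG₁⟩
    have hk0 : EuclideanDomain.gcd F G ≠ 0 := fun h0 => hF0 (by rw [hF₁, h0, zero_mul])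
    apply mul_left_cancel₀ hk0
    have hbez := EuclideanDomain.gcd_eq_gcd_ab F G
    linear_combination -hbez - EuclideanDomain.gcdA F G * hF₁ - EuclideanDomain.gcdB F G * hG₁
  have hk : ∀ x, 0 ≤ x → eval x k ≠ 0 ∧ eval x F₁ ≠ 0 := by
    intro x hx
    have := hpos x hx
    rw [hFk, eval_mul] at this
    exact mul_ne_zero_iff.1 this
  have hk' : ∀ z : ℂ, 0 < z.im → aeval z k ≠ 0 ∧ aeval z F₁ ≠ 0 := by
    intro x hx
    have := hF x hx
    rw [hFk, map_mul] at this
    exact mul_ne_zero_iff.1 this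
  have key := tangent_inequality_of_coprime hco (fun z hz => (hk' z hz).2)
    (fun x hx => (hk x hx).2) (fun z hz => ?_) ht
  · have h1 := hk t ht
    have h2 := hk 0 le_rfl
    rw [hFk, hGk]
    simp only [eval_mul, derivative_mul, eval_add]
    rw [mul_div_mul_left _ _ h1.1, mul_div_mul_left _ _ h2.1]
    refine le_trans (le_of_eq ?_) key
    congr 2
    have h3 := h1.1
    have h4 := h1.2
    field_simp
    ring
  · have h1 := h z hz
    rw [hFk, hGk, map_mul, map_mul, map_mul, mul_mul_mul_comm, Complex.mul_conj,
      Complex.im_ofReal_mul] at h1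
    exact nonpos_of_mul_nonpos_right h1 (Complex.normSq_pos.2 (hk' z hz).1)

end

namespace RealStable

/-! ### Stable polynomials and directional derivatives -/

section stability

open ComplexConjugate Filter Topology

open Polynomial in
/-- The logarithmic derivative at the origin of a polynomial without zeros in the closed upper half
plane has nonpositive imaginary part and is different from `1`. -/
theorem logDeriv_zero_of_no_root {q : ℂ[X]} (hq : ∀ t : ℂ, 0 ≤ t.im → eval t q ≠ 0) :
    (eval 0 (derivative q) / eval 0 q).im ≤ 0 ∧ eval 0 (derivative q) ≠ eval 0 q := by
  have h0 : eval 0 q ≠ 0 := hq 0 le_rfl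
  have hq0 : q ≠ 0 := by rintro rfl; simp at h0
  have hsum := (IsAlgClosed.splits q).eval_derivative_div_eval_of_ne_zero h0
  have him : (eval 0 (derivative q) / eval 0 q).im =
      (q.roots.map fun z => (1 / (0 - z)).im).sum := by
    rw [hsum]
    have := map_multiset_sum Complex.imAddGroupHom (q.roots.map fun z => 1 / (0 - z))
    rw [Multiset.map_map] at this
    exact this
  have hneg : ∀ z ∈ q.roots, (1 / (0 - z)).im < 0 := by
    intro z hz
    have hz0 : z.im < 0 := by
      by_contra h
      exact hq z (not_lt.1 h) ((mem_roots hq0).1 hz)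
    have hzne : z ≠ 0 := by rintro rfl; simp at hz0
    rw [one_div, Complex.inv_im]
    simpa using div_neg_of_neg_of_pos hz0 (Complex.normSq_pos.2 hzne)
  constructor
  · rw [him]
    refine (Multiset.sum_map_le_sum_map _ (fun _ => 0) fun z hz => (hneg z hz).le).trans ?_
    simp
  -- If the value were `1`, the strictly negative imaginary parts would sum to `0`, so there would
  -- be no roots; but then the sum over the roots is `0`, not `1`.
  · intro heq
    rw [heq, div_self h0, Complex.one_im] at him
    have hempty : q.roots = 0 := by
      by_contra hne
      have := Multiset.sum_lt_sum_of_nonempty hne (f := fun z => (1 / (0 - z)).im)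
        (g := fun _ => 0) hneg
      rw [← him] at this
      simp at this
    rw [hempty, heq, div_self h0] at hsum
    simp at hsum

open MvPolynomial

variable {ι : Type*}

/-- The derivative of a polynomial in the direction `c`. -/
noncomputable def dirDeriv (c : ι → ℝ) : Derivation ℝ (MvPolynomial ι ℝ) (MvPolynomial ι ℝ) :=
  mkDerivation ℝ fun a => C (c a)

@[simp]
theorem dirDeriv_X (c : ι → ℝ) (a : ι) : dirDeriv c (X a) = C (c a) := mkDerivation_X _ _ _

theorem dirDeriv_comm (b c : ι → ℝ) (p : MvPolynomial ι ℝ) :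
    dirDeriv b (dirDeriv c p) = dirDeriv c (dirDeriv b p) := by
  have h : ⁅dirDeriv b, dirDeriv c⁆ = 0 := by
    apply derivation_ext
    intro i
    simp [Derivation.commutator_apply, derivation_C]
  have h2 := congrArg (fun D => D p) h
  simp only [Derivation.commutator_apply, Derivation.zero_apply] at h2
  exact sub_eq_zero.1 h2

theorem dirDeriv_sum {κ : Type*} (s : Finset κ) (b : κ → ι → ℝ) (p : MvPolynomial ι ℝ) :
    dirDeriv (∑ k ∈ s, b k) p = ∑ k ∈ s, dirDeriv (b k) p := by
  have h : dirDeriv (∑ k ∈ s, b k) = ∑ k ∈ s, dirDeriv (b k) := by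
    apply derivation_ext
    intro i
    rw [← Derivation.coeFnAddMonoidHom_apply (∑ k ∈ s, dirDeriv (b k)), map_sum]
    simp
  rw [h, ← Derivation.coeFnAddMonoidHom_apply, map_sum]
  simp

theorem dirDeriv_smul (r : ℝ) (c : ι → ℝ) (p : MvPolynomial ι ℝ) :
    dirDeriv (r • c) p = r • dirDeriv c p := by
  have h : dirDeriv (r • c) = r • dirDeriv c := by
    apply derivation_ext
    intro i
    simp [MvPolynomial.smul_eq_C_mul]
  rw [h, Derivation.smul_apply]

/-- The restriction `t ↦ p (x + t c)` of a polynomial to a line. -/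
noncomputable def restrictLine {K : Type*} [CommRing K] [Algebra ℝ K] (x : ι → K) (c : ι → ℝ)
    (p : MvPolynomial ι ℝ) : Polynomial K :=
  aeval (fun a => Polynomial.C (x a) + Polynomial.C (algebraMap ℝ K (c a)) * Polynomial.X) p

section restrictLine

variable {K : Type*} [CommRing K] [Algebra ℝ K]

theorem eval_restrictLine (x : ι → K) (c : ι → ℝ) (p : MvPolynomial ι ℝ) (t : K) :
    Polynomial.eval t (restrictLine x c p) = aeval (fun a => x a + algebraMap ℝ K (c a) * t) p := by
  rw [restrictLine]
  have h := congrArg (fun f => f p) (comp_aeval (R := ℝ)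
    (fun a => Polynomial.C (x a) + Polynomial.C (algebraMap ℝ K (c a)) * Polynomial.X)
    ((Polynomial.aeval t : Polynomial K →ₐ[K] K).restrictScalars ℝ))
  simpa [Polynomial.aeval_def, Polynomial.eval₂_eq_eval_map] using h

theorem aeval_restrictLine {x c : ι → ℝ} (p : MvPolynomial ι ℝ) (z : K) :
    Polynomial.aeval z (restrictLine x c p) =
      aeval (fun a => algebraMap ℝ K (x a) + algebraMap ℝ K (c a) * z) p := by
  rw [restrictLine]
  have h := congrArg (fun f => f p) (comp_aeval (R := ℝ)
    (fun a => Polynomial.C (x a) + Polynomial.C (algebraMap ℝ ℝ (c a)) * Polynomial.X)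
    (Polynomial.aeval z : Polynomial ℝ →ₐ[ℝ] K))
  simpa using h

theorem derivative_restrictLine (x : ι → K) (c : ι → ℝ) (p : MvPolynomial ι ℝ) :
    Polynomial.derivative (restrictLine x c p) = restrictLine x c (dirDeriv c p) := by
  unfold restrictLine
  induction p using MvPolynomial.induction_on with
  | C a => simp [derivation_C, Polynomial.algebraMap_apply]
  | add p q hp hq => simp only [map_add, hp, hq]
  | mul_X p i hp =>
    simp only [map_mul, Polynomial.derivative_mul, hp, Derivation.leibniz, map_add, smul_eq_mul,
      dirDeriv_X, aeval_X, algHom_C, Polynomial.algebraMap_apply, Polynomial.derivative_C,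
      Polynomial.derivative_X]
    ring

end restrictLine

/-- A polynomial is stable if it has no zeros with all coordinates in the open upper half plane. -/
def Stable (p : MvPolynomial ι ℝ) : Prop :=
  ∀ w : ι → ℂ, (∀ a, 0 < (w a).im) → aeval w p ≠ 0

theorem Stable.restrictLine_ne_zero {p : MvPolynomial ι ℝ} (hp : Stable p) {c : ι → ℝ}
    (hc : 0 ≤ c) {w : ι → ℂ} (hw : ∀ a, 0 < (w a).im) {t : ℂ} (ht : 0 ≤ t.im) :
    Polynomial.eval t (restrictLine w c p) ≠ 0 := by
  rw [eval_restrictLine]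
  refine hp _ fun a => ?_
  have : 0 ≤ c a * t.im := mul_nonneg (hc a) ht
  simpa using add_pos_of_pos_of_nonneg (hw a) this

/-- On the line `w + t c` the restriction has no zeros for `Im t ≥ 0`, so its logarithmic derivative
`D_c p / p` at `t = 0` cannot equal `1`. -/
theorem Stable.sub_dirDeriv {p : MvPolynomial ι ℝ} (hp : Stable p) {c : ι → ℝ} (hc : 0 ≤ c) :
    Stable (p - dirDeriv c p) := by
  intro w hw h0
  have h := (logDeriv_zero_of_no_root fun t ht => hp.restrictLine_ne_zero hc hw ht).2
  rw [derivative_restrictLine, eval_restrictLine, eval_restrictLine] at h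
  simp only [mul_zero, add_zero] at h
  rw [map_sub, sub_eq_zero] at h0
  exact h h0.symm

/-- Multiplying by `conj p` instead of dividing by `p` lets the inequality pass to the closed half
plane, where `p` may vanish. This is needed because `x + z c` has real coordinates wherever `c` is
zero. -/
theorem Stable.im_dirDeriv_mul_conj_nonpos {p : MvPolynomial ι ℝ} (hp : Stable p) {c : ι → ℝ}
    (hc : 0 ≤ c) {w : ι → ℂ} (hw : ∀ a, 0 ≤ (w a).im) :
    (aeval w (dirDeriv c p) * conj (aeval w p)).im ≤ 0 := by
  have hopen : ∀ w : ι → ℂ, (∀ a, 0 < (w a).im) →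
      (aeval w (dirDeriv c p) * conj (aeval w p)).im ≤ 0 := by
    intro w hw
    have h := (logDeriv_zero_of_no_root fun t ht => hp.restrictLine_ne_zero hc hw ht).1
    rw [derivative_restrictLine, eval_restrictLine, eval_restrictLine] at h
    simp only [mul_zero, add_zero] at h
    have hne := hp w hw
    have e : aeval w (dirDeriv c p) * conj (aeval w p) =
        ((Complex.normSq (aeval w p) : ℝ) : ℂ) * (aeval w (dirDeriv c p) / aeval w p) := by
      rw [← Complex.mul_conj]
      field_simp
    rw [e, Complex.im_ofReal_mul]
    exact mul_nonpos_of_nonneg_of_nonpos (Complex.normSq_nonneg _) h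
  have hcont : ∀ q : MvPolynomial ι ℝ,
      Continuous fun s : ℝ => aeval (fun a => w a + s * Complex.I) q := by
    intro q
    have h1 : Continuous fun s : ℝ => Polynomial.eval (s * Complex.I) (restrictLine w 1 q) :=
      (restrictLine w 1 q).continuous.comp (by fun_prop)
    simpa [eval_restrictLine] using h1
  let φ : ℝ → ℝ := fun s => (aeval (fun a => w a + s * Complex.I) (dirDeriv c p) *
    conj (aeval (fun a => w a + s * Complex.I) p)).im
  have hφ : Continuous φ := Complex.continuous_im.comp
    ((hcont _).mul (Complex.continuous_conj.comp (hcont _)))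
  have h0 : φ 0 = (aeval w (dirDeriv c p) * conj (aeval w p)).im := by simp [φ]
  rw [← h0]
  refine le_of_tendsto (hφ.continuousAt.mono_left nhdsWithin_le_nhds : Tendsto φ (𝓝[>] 0) _) ?_
  filter_upwards [self_mem_nhdsWithin] with s hs
  have hs : 0 < s := hs
  refine hopen _ fun a => ?_
  simpa using add_pos_of_nonneg_of_pos (hw a) hs

theorem Stable.im_restrictLine_nonpos {p : MvPolynomial ι ℝ} (hp : Stable p) (x : ι → ℝ)
    {b c : ι → ℝ} (hb : 0 ≤ b) (hc : 0 ≤ c) {z : ℂ} (hz : 0 < z.im) :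
    (Polynomial.aeval z (restrictLine x c (dirDeriv b p)) *
      conj (Polynomial.aeval z (restrictLine x c p))).im ≤ 0 := by
  rw [aeval_restrictLine, aeval_restrictLine]
  refine hp.im_dirDeriv_mul_conj_nonpos hb fun a => ?_
  simpa using mul_nonneg (hc a) hz.le

theorem eval_restrictLine_real (x c : ι → ℝ) (p : MvPolynomial ι ℝ) (t : ℝ) :
    Polynomial.eval t (restrictLine x c p) = eval (x + t • c) p := by
  have h : (fun a => x a + algebraMap ℝ ℝ (c a) * t) = x + t • c := by
    ext a
    simp [mul_comm]
  rw [eval_restrictLine, h, aeval_eq_eval]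

/-- The quotient `D_b p / p` is antitone along a ray in a nonnegative direction on which `p` is
positive. -/
theorem Stable.antitoneOn {p : MvPolynomial ι ℝ} (hp : Stable p) (x : ι → ℝ)
    {b c : ι → ℝ} (hb : 0 ≤ b) (hc : 0 ≤ c) {s : Set ℝ} (hs : Convex ℝ s)
    (hpos : ∀ t ∈ s, 0 < eval (x + t • c) p) :
    AntitoneOn (fun t : ℝ => eval (x + t • c) (dirDeriv b p) / eval (x + t • c) p) s := by
  simp only [← eval_restrictLine_real] at hpos ⊢
  have hd : ∀ t ∈ s, HasDerivAt (fun t : ℝ => Polynomial.eval t (restrictLine x c (dirDeriv b p)) /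
      Polynomial.eval t (restrictLine x c p)) _ t := fun t ht =>
    (Polynomial.hasDerivAt _ t).div (Polynomial.hasDerivAt _ t) (hpos t ht).ne'
  refine antitoneOn_of_deriv_nonpos hs (fun t ht => (hd t ht).continuousAt.continuousWithinAt)
    (fun t ht => (hd t (interior_subset ht)).differentiableAt.differentiableWithinAt)
    fun t ht => ?_
  rw [(hd t (interior_subset ht)).deriv]
  exact div_nonpos_of_nonpos_of_nonneg
    (wronskian_nonpos (fun z hz => hp.im_restrictLine_nonpos x hb hc hz) t) (sq_nonneg _)

/-! ### The barrier argument -/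

/-- The polynomial `p` is positive on the translated orthant with vertex `x`. -/
def Above (p : MvPolynomial ι ℝ) (x : ι → ℝ) : Prop :=
  ∀ y, x ≤ y → 0 < eval y p

/-- The barrier function `D_b p / p` decreases along the segment from `x` to `y`, so a bound at the
vertex holds on the whole orthant. -/
theorem Above.dirDeriv_le {p : MvPolynomial ι ℝ} (hp : Stable p) {x : ι → ℝ} (hx : Above p x)
    {b : ι → ℝ} (hb : 0 ≤ b) {y : ι → ℝ} (hy : x ≤ y) {κ : ℝ}
    (hκ : eval x (dirDeriv b p) ≤ κ * eval x p) : eval y (dirDeriv b p) ≤ κ * eval y p := by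
  have hyx : 0 ≤ y - x := sub_nonneg.2 hy
  have h := hp.antitoneOn x hb hyx (convex_Icc (0 : ℝ) 1)
    (fun t ht => hx _ (le_add_of_nonneg_right (smul_nonneg ht.1 hyx)))
    (Set.left_mem_Icc.2 zero_le_one) (Set.right_mem_Icc.2 zero_le_one) zero_le_one
  simp only [one_smul, add_sub_cancel, zero_smul, add_zero] at h
  rw [div_le_div_iff₀ (hx y hy) (hx x le_rfl)] at h
  have h1 := hx x le_rfl
  have h2 := hx y hy
  have h3 := mul_le_mul_of_nonneg_right hκ h2.le
  have h4 : eval y (dirDeriv b p) * eval x p ≤ κ * eval y p * eval x p := by linarith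
  exact le_of_mul_le_mul_right h4 h1

/-- The barrier argument: if `D_c p ≤ (1 - 1 / δ) p` at `x`, then `p - D_c p` is positive above
`x + δ c`, and the barrier functions do not increase. -/
theorem barrier_step {p : MvPolynomial ι ℝ} (hp : Stable p) {x : ι → ℝ} (hx : Above p x)
    {c : ι → ℝ} (hc : 0 ≤ c) {δ : ℝ} (hδ : 0 < δ)
    (hΦ : eval x (dirDeriv c p) ≤ (1 - 1 / δ) * eval x p) :
    Above (p - dirDeriv c p) (x + δ • c) ∧ ∀ b, 0 ≤ b → ∀ κ,
      eval x (dirDeriv b p) ≤ κ * eval x p →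
      eval (x + δ • c) (dirDeriv b (p - dirDeriv c p)) ≤
        κ * eval (x + δ • c) (p - dirDeriv c p) := by
  have hle : x ≤ x + δ • c := le_add_of_nonneg_right (smul_nonneg hδ.le hc)
  have habove : Above (p - dirDeriv c p) (x + δ • c) := by
    intro y hy
    have h1 := hx.dirDeriv_le hp hc (hle.trans hy) hΦ
    have h2 := hx y (hle.trans hy)
    have h3 : 0 < 1 / δ := by positivity
    rw [map_sub]
    nlinarith
  refine ⟨habove, fun b hb κ hκ => ?_⟩
  set F := restrictLine x c p with hF
  set G := restrictLine x c (dirDeriv b p) with hG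
  have hFev : ∀ t, Polynomial.eval t F = eval (x + t • c) p := eval_restrictLine_real x c p
  have hpos : ∀ t, 0 ≤ t → 0 < Polynomial.eval t F := fun t ht => by
    rw [hFev]
    exact hx _ (le_add_of_nonneg_right (smul_nonneg ht hc))
  have hF0 : F ≠ 0 := by
    intro h
    have := hpos 0 le_rfl
    rw [h] at this
    simp at this
  -- Stability does not apply directly, since `c` may have zero coordinates; the sign of `Im (F'
  -- conj F)` excludes the zeros instead.
  have hnr : ∀ z : ℂ, 0 < z.im → Polynomial.aeval z F ≠ 0 := fun z hz =>
    aeval_ne_zero_of_im_derivative_mul_conj_nonpos hF0 (fun z hz => by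
      rw [hF, derivative_restrictLine]
      exact hp.im_restrictLine_nonpos x hc hc hz) hz
  have him : ∀ z : ℂ, 0 < z.im →
      (Polynomial.aeval z G * conj (Polynomial.aeval z F)).im ≤ 0 := fun z hz =>
    hp.im_restrictLine_nonpos x hb hc hz
  have htan := tangent_inequality hnr (fun t ht => (hpos t ht).ne') him hδ.le
  have hw := wronskian_nonpos him δ
  have hL := hx.dirDeriv_le hp hc hle hΦ
  have hnew := habove _ le_rfl
  have hGev : ∀ t, Polynomial.eval t G = eval (x + t • c) (dirDeriv b p) :=
    eval_restrictLine_real x c _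
  have hF'ev : Polynomial.eval δ (Polynomial.derivative F) = eval (x + δ • c) (dirDeriv c p) := by
    rw [hF, derivative_restrictLine, eval_restrictLine_real]
  have hG'ev : Polynomial.eval δ (Polynomial.derivative G) =
      eval (x + δ • c) (dirDeriv b (dirDeriv c p)) := by
    rw [hG, derivative_restrictLine, eval_restrictLine_real, dirDeriv_comm]
  have hpd := hpos δ hδ.le
  have hp0 := hpos 0 le_rfl
  rw [map_sub] at hnew
  rw [map_sub, map_sub, map_sub]
  rw [← hFev, ← hF'ev] at hnew hL ⊢
  rw [← hGev, ← hG'ev]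
  have hκ' : Polynomial.eval 0 G / Polynomial.eval 0 F ≤ κ := by
    rw [div_le_iff₀ hp0, hFev, hGev]
    simpa using hκ
  generalize Polynomial.eval δ F = f at *
  generalize Polynomial.eval δ G = g at *
  generalize Polynomial.eval δ (Polynomial.derivative F) = f' at *
  generalize Polynomial.eval δ (Polynomial.derivative G) = g' at *
  -- With `φ = g / f`, the new barrier value is `(g - g') / (f - f') = φ - φ' / (1 - f' / f)`. As
  -- `φ' ≤ 0` and `1 / (1 - f' / f) ≤ δ`, it is at most `φ(δ) - δ φ'(δ)`, which the tangent
  -- inequality bounds by `φ(0) ≤ κ`.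
  have h1 : f ≤ δ * (f - f') := by
    have : (1 - 1 / δ) * f = f - f / δ := by ring
    rw [this] at hL
    have h2 : f / δ ≤ f - f' := by linarith
    rw [div_le_iff₀ hδ] at h2
    linarith
  have h2 : g / f - δ * ((g' * f - g * f') / f ^ 2) ≤ κ := htan.trans hκ'
  have h3 : g * f - δ * (g' * f - g * f') ≤ κ * f ^ 2 := by
    have : g / f - δ * ((g' * f - g * f') / f ^ 2) =
        (g * f - δ * (g' * f - g * f')) / f ^ 2 := by
      field_simp
    rw [this, div_le_iff₀ (by positivity)] at h2
    exact h2
  have h4 : (g - g') * f ^ 2 ≤ κ * (f - f') * f ^ 2 := by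
    have h5 := mul_le_mul_of_nonneg_right h3 hnew.le
    have h6 := mul_le_mul_of_nonneg_right h1 (neg_nonneg.2 hw)
    nlinarith
  exact le_of_mul_le_mul_right h4 (by positivity)

/-- Successive application of the operators `1 - D_c`, for `c` in a list of directions. -/
noncomputable def applyOps (l : List (ι → ℝ)) (p : MvPolynomial ι ℝ) : MvPolynomial ι ℝ :=
  l.foldl (fun q c => q - dirDeriv c q) p

theorem applyOps_cons (c : ι → ℝ) (l : List (ι → ℝ)) (p : MvPolynomial ι ℝ) :
    applyOps (c :: l) p = applyOps l (p - dirDeriv c p) := rfl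

/-- Directional derivatives commute, so any one operator may be treated as the last one applied. -/
theorem applyOps_sub_dirDeriv (c : ι → ℝ) (l : List (ι → ℝ)) (p : MvPolynomial ι ℝ) :
    applyOps l (p - dirDeriv c p) = applyOps l p - dirDeriv c (applyOps l p) := by
  induction l generalizing p with
  | nil => rfl
  | cons b l ih =>
    rw [applyOps_cons, applyOps_cons, ← ih]
    have h : p - dirDeriv c p - dirDeriv b (p - dirDeriv c p) =
        p - dirDeriv b p - dirDeriv c (p - dirDeriv b p) := by
      rw [map_sub, map_sub, dirDeriv_comm b c]
      abel
    rw [h]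

theorem Stable.applyOps {l : List (ι → ℝ)} (hl : ∀ c ∈ l, 0 ≤ c) {p : MvPolynomial ι ℝ}
    (hp : Stable p) : Stable (applyOps l p) := by
  induction l generalizing p with
  | nil => exact hp
  | cons c l ih =>
    exact ih (fun b hb => hl b (List.mem_cons_of_mem _ hb))
      (hp.sub_dirDeriv (hl c List.mem_cons_self))

/-- Iterated barrier argument. -/
theorem above_applyOps {l : List (ι → ℝ)} (hl : ∀ c ∈ l, 0 ≤ c) {p : MvPolynomial ι ℝ}
    (hp : Stable p) {x : ι → ℝ} (hx : Above p x) {δ : ℝ} (hδ : 0 < δ)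
    (hΦ : ∀ c ∈ l, eval x (dirDeriv c p) ≤ (1 - 1 / δ) * eval x p) :
    Above (RealStable.applyOps l p) (x + δ • l.sum) := by
  induction l generalizing p x with
  | nil => simpa [RealStable.applyOps] using hx
  | cons c l ih =>
    have hc := hl c List.mem_cons_self
    have hl' : ∀ b ∈ l, 0 ≤ b := fun b hb => hl b (List.mem_cons_of_mem _ hb)
    obtain ⟨h1, h2⟩ := barrier_step hp hx hc hδ (hΦ c List.mem_cons_self)
    rw [applyOps_cons, List.sum_cons, smul_add, ← add_assoc]
    exact ih hl' (hp.sub_dirDeriv hc) h1 fun b hb =>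
      h2 b (hl' b hb) _ (hΦ b (List.mem_cons_of_mem _ hb))

/-! ### Positivity on the diagonal and the choice of directions -/

/-- The polynomial `p` has degree at most `N`, and its restriction to the diagonal is monic of
degree `N`. -/
def DiagMonic (N : ℕ) (p : MvPolynomial ι ℝ) : Prop :=
  p.totalDegree ≤ N ∧ (restrictLine (0 : ι → ℝ) 1 p).coeff N = 1

theorem degree_add_one_le_of_mem_support_pderiv {N : ℕ} {p : MvPolynomial ι ℝ}
    (hp : p.totalDegree ≤ N) (a : ι) {s : ι →₀ ℕ} (hs : s ∈ (pderiv a p).support) :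
    s.degree + 1 ≤ N := by
  classical
  rw [mem_support_iff, coeff_pderiv] at hs
  have h1 : s + Finsupp.single a 1 ∈ p.support := mem_support_iff.2 (left_ne_zero_of_mul hs)
  have h2 := (le_totalDegree h1).trans hp
  have h3 : (s + Finsupp.single a 1).degree = s.degree + 1 := by simp
  rw [← h3]
  exact h2

theorem dirDeriv_eq_sum [Fintype ι] (c : ι → ℝ) (p : MvPolynomial ι ℝ) :
    dirDeriv c p = ∑ a, C (c a) * pderiv a p := by
  classical
  have h : dirDeriv c = ∑ a, c a • pderiv (R := ℝ) a := by
    apply derivation_ext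
    intro i
    rw [← Derivation.coeFnAddMonoidHom_apply (∑ a, c a • pderiv (R := ℝ) a), map_sum]
    simp [pderiv_X, Pi.single_apply, MvPolynomial.smul_eq_C_mul]
  rw [h, ← Derivation.coeFnAddMonoidHom_apply, map_sum]
  simp [MvPolynomial.smul_eq_C_mul]

/-- Differentiation lowers the degree, so the top coefficient on the diagonal is untouched. -/
theorem DiagMonic.sub_dirDeriv [Fintype ι] {N : ℕ} {p : MvPolynomial ι ℝ} (hp : DiagMonic N p)
    (c : ι → ℝ) : DiagMonic N (p - dirDeriv c p) := by
  have hdeg : ∀ a, (C (c a) * pderiv a p).totalDegree ≤ N := by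
    intro a
    refine (totalDegree_mul _ _).trans ?_
    rw [totalDegree_C, zero_add]
    refine Finset.sup_le fun s hs => ?_
    have := degree_add_one_le_of_mem_support_pderiv hp.1 a hs
    exact (Nat.le_succ _).trans this
  constructor
  · refine (totalDegree_sub _ _).trans (max_le hp.1 ?_)
    rw [dirDeriv_eq_sum]
    exact totalDegree_finsetSum_le fun a _ => hdeg a
  · have hcoeff : ∀ a, (restrictLine (0 : ι → ℝ) 1 (pderiv a p)).coeff N = 0 := by
      intro a
      by_cases h0 : pderiv a p = 0
      · rw [h0, restrictLine, map_zero, Polynomial.coeff_zero]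
      obtain ⟨s, hs⟩ := Finset.nonempty_iff_ne_empty.2 (mt support_eq_empty.1 h0)
      have hN : 0 < N := (Nat.succ_pos _).trans_le (degree_add_one_le_of_mem_support_pderiv hp.1 a hs)
      apply Polynomial.coeff_eq_zero_of_natDegree_lt
      have h1 : (pderiv a p).totalDegree ≤ N - 1 := Finset.sup_le fun s hs =>
        Nat.le_sub_one_of_lt (degree_add_one_le_of_mem_support_pderiv hp.1 a hs)
      have h2 : (restrictLine (0 : ι → ℝ) 1 (pderiv a p)).natDegree ≤ (N - 1) * 1 :=
        aeval_natDegree_le _ h1 _ fun i => by simp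
      omega
    have h3 : (restrictLine (0 : ι → ℝ) 1 (dirDeriv c p)).coeff N = 0 := by
      rw [dirDeriv_eq_sum, restrictLine, map_sum, Polynomial.finsetSum_coeff]
      refine Finset.sum_eq_zero fun a _ => ?_
      rw [map_mul, algHom_C, Polynomial.algebraMap_apply, Polynomial.coeff_C_mul]
      have := hcoeff a
      rw [restrictLine] at this
      rw [this, mul_zero]
    have h4 : restrictLine (0 : ι → ℝ) 1 (p - dirDeriv c p) =
        restrictLine (0 : ι → ℝ) 1 p - restrictLine (0 : ι → ℝ) 1 (dirDeriv c p) := map_sub _ _ _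
    rw [h4, Polynomial.coeff_sub, h3, hp.2, sub_zero]

theorem DiagMonic.applyOps [Fintype ι] {N : ℕ} {p : MvPolynomial ι ℝ} (hp : DiagMonic N p)
    (l : List (ι → ℝ)) : DiagMonic N (applyOps l p) := by
  induction l generalizing p with
  | nil => exact hp
  | cons c l ih => exact ih (hp.sub_dirDeriv c)

theorem eval_restrictLine_diag (p : MvPolynomial ι ℝ) (s : ℝ) :
    Polynomial.eval s (restrictLine (0 : ι → ℝ) 1 p) = eval (s • (1 : ι → ℝ)) p := by
  rw [eval_restrictLine_real, zero_add]

/-- This bounds the zeros on the diagonal from above, so that one may speak of a largest zero. -/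
theorem DiagMonic.eventually_pos {N : ℕ} {p : MvPolynomial ι ℝ} (hp : DiagMonic N p) :
    ∀ᶠ s : ℝ in atTop, 0 < eval (s • (1 : ι → ℝ)) p := by
  simp only [← eval_restrictLine_diag]
  set f := restrictLine (0 : ι → ℝ) 1 p with hf
  have h1 : f.natDegree ≤ N * 1 := aeval_natDegree_le _ hp.1 _ fun i => by simp
  rw [mul_one] at h1
  have h2 : f.natDegree = N := Polynomial.natDegree_eq_of_le_of_coeff_ne_zero h1 (by
    rw [hp.2]; exact one_ne_zero)
  have h3 : f.leadingCoeff = 1 := by rw [Polynomial.leadingCoeff, h2, hp.2]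
  rcases Nat.eq_zero_or_pos N with h0 | hN
  · rw [h0] at h2
    rw [Polynomial.eq_C_of_natDegree_eq_zero h2]
    have : f.coeff 0 = 1 := by rw [← h3, Polynomial.leadingCoeff, h2]
    simp [this]
  · have := f.tendsto_atTop_of_leadingCoeff_nonneg
      (Polynomial.natDegree_pos_iff_degree_pos.1 (by omega)) (by rw [h3]; exact zero_le_one)
    exact this.eventually_gt_atTop 0

theorem continuous_eval_diag (p : MvPolynomial ι ℝ) :
    Continuous fun s : ℝ => eval (s • (1 : ι → ℝ)) p := by
  simp only [← eval_restrictLine_diag]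
  exact Polynomial.continuous _

theorem Stable.antitoneOn_diag {p : MvPolynomial ι ℝ} (hp : Stable p)
    {b : ι → ℝ} (hb : 0 ≤ b) {s : Set ℝ} (hs : Convex ℝ s)
    (hpos : ∀ t ∈ s, 0 < eval (t • (1 : ι → ℝ)) p) :
    AntitoneOn (fun t : ℝ => eval (t • (1 : ι → ℝ)) (dirDeriv b p) /
      eval (t • (1 : ι → ℝ)) p) s := by
  have := hp.antitoneOn 0 hb (zero_le_one : (0 : ι → ℝ) ≤ 1) hs (by simpa using hpos)
  simpa using this

/-- On the diagonal, the largest zero of `p` does not exceed that of `p - D_c p`. -/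
theorem Stable.diag_pos_of_sub_dirDeriv_pos {p : MvPolynomial ι ℝ} (hp : Stable p)
    (hev : ∀ᶠ s : ℝ in atTop, 0 < eval (s • (1 : ι → ℝ)) p) {c : ι → ℝ} (hc : 0 ≤ c) {T : ℝ}
    (h : ∀ s, T ≤ s → 0 < eval (s • (1 : ι → ℝ)) (p - dirDeriv c p)) {s : ℝ} (hs : T ≤ s) :
    0 < eval (s • (1 : ι → ℝ)) p := by
  by_contra hneg
  set f : ℝ → ℝ := fun s => eval (s • (1 : ι → ℝ)) p with hf
  set g : ℝ → ℝ := fun s => eval (s • (1 : ι → ℝ)) (dirDeriv c p) with hg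
  have hfc : Continuous f := continuous_eval_diag p
  have hgc : Continuous g := continuous_eval_diag _
  let Z : Set ℝ := {x | f x ≤ 0}
  have hZs : s ∈ Z := not_lt.1 hneg
  have hZc : IsClosed Z := isClosed_le hfc continuous_const
  have hZb : BddAbove Z := by
    obtain ⟨B, hB⟩ := eventually_atTop.1 hev
    refine ⟨B, fun x hx => ?_⟩
    by_contra hBx
    exact absurd (hB x (not_le.1 hBx).le) (not_lt.2 hx)
  set a := sSup Z with ha
  have haZ : f a ≤ 0 := hZc.csSup_mem ⟨s, hZs⟩ hZb
  have hTa : T ≤ a := hs.trans (le_csSup hZb hZs)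
  have hpos : ∀ x ∈ Set.Ioi a, 0 < f x := by
    intro x hx
    by_contra hx0
    exact absurd (le_csSup hZb (not_lt.1 hx0 : x ∈ Z)) (not_le.2 hx)
  have hanti := hp.antitoneOn_diag hc (convex_Ioi a) hpos
  have hga : g a < f a := by
    have := h a hTa
    rw [map_sub] at this
    exact sub_pos.1 this
  set M := g (a + 1) / f (a + 1) with hM
  -- Since `g / f` decreases on `(a, ∞)`, it stays above `M` near `a`. In the limit `g a ≥ M * f a =
  -- 0`, contradicting `g a < f a = 0`.
  have hge : ∀ᶠ x in 𝓝[>] a, M * f x ≤ g x := by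
    have hlt : ∀ᶠ x in 𝓝[>] a, x < a + 1 := nhdsWithin_le_nhds (Iio_mem_nhds (by linarith))
    filter_upwards [hlt, self_mem_nhdsWithin] with x hx hxa
    have h1 : g (a + 1) / f (a + 1) ≤ g x / f x :=
      hanti hxa (Set.mem_Ioi.2 (lt_add_one a)) hx.le
    exact (le_div_iff₀ (hpos x hxa)).1 h1
  have hfa : 0 ≤ f a := by
    refine ge_of_tendsto (hfc.continuousAt.mono_left nhdsWithin_le_nhds : Tendsto f (𝓝[>] a) _) ?_
    filter_upwards [self_mem_nhdsWithin] with x hx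
    exact (hpos x hx).le
  have hlim : M * f a ≤ g a :=
    le_of_tendsto_of_tendsto
      ((continuous_const.mul hfc).continuousAt.mono_left nhdsWithin_le_nhds :
        Tendsto (fun x => M * f x) (𝓝[>] a) _)
      (hgc.continuousAt.mono_left nhdsWithin_le_nhds : Tendsto g (𝓝[>] a) _) hge
  have hfa0 : f a = 0 := le_antisymm haZ hfa
  rw [hfa0, mul_zero] at hlim
  linarith

/-- If `c` is the average of the directions `b k`, then for some `k` the largest diagonal zero of
`p - D_{b k} p` does not exceed that of `p - D_c p`. -/
theorem Stable.exists_sub_dirDeriv_pos {p : MvPolynomial ι ℝ} (hp : Stable p)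
    (hev : ∀ᶠ s : ℝ in atTop, 0 < eval (s • (1 : ι → ℝ)) p) {r : ℕ} (hr : 0 < r)
    {b : Fin r → ι → ℝ} (hb : ∀ k, 0 ≤ b k) {c : ι → ℝ} (hc : 0 ≤ c)
    (hbc : (r : ℝ) • c = ∑ k, b k) {T : ℝ}
    (h : ∀ s, T ≤ s → 0 < eval (s • (1 : ι → ℝ)) (p - dirDeriv c p)) :
    ∃ k, ∀ s, T ≤ s → 0 < eval (s • (1 : ι → ℝ)) (p - dirDeriv (b k) p) := by
  have hpos : ∀ s, T ≤ s → 0 < eval (s • (1 : ι → ℝ)) p := fun s hs =>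
    hp.diag_pos_of_sub_dirDeriv_pos hev hc h hs
  -- At `T` the values of `D_{b k} p` average to `D_c p < p`, so one of them lies below `p`. The
  -- decrease of `D_{b k} p / p` carries this to all `s ≥ T`.
  obtain ⟨k, hk⟩ : ∃ k, eval (T • (1 : ι → ℝ)) (dirDeriv (b k) p) < eval (T • (1 : ι → ℝ)) p := by
    by_contra! hall
    have h1 := Finset.sum_le_sum fun k (_ : k ∈ Finset.univ) => hall k
    have hsum : ∑ k, eval (T • (1 : ι → ℝ)) (dirDeriv (b k) p) =
        eval (T • (1 : ι → ℝ)) ((r : ℝ) • dirDeriv c p) := by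
      rw [← map_sum, ← dirDeriv_sum, ← hbc, dirDeriv_smul]
    rw [hsum] at h1
    simp only [Finset.sum_const, Finset.card_univ, Fintype.card_fin, nsmul_eq_mul, smul_eval] at h1
    have h2 := h T le_rfl
    rw [map_sub, sub_pos] at h2
    have hr' : (0 : ℝ) < r := by exact_mod_cast hr
    exact absurd (le_of_mul_le_mul_left h1 hr') (not_le.2 h2)
  refine ⟨k, fun s hs => ?_⟩
  have hanti := hp.antitoneOn_diag (hb k) (convex_Ici T) hpos Set.self_mem_Ici hs hs
  have h1 : eval (T • (1 : ι → ℝ)) (dirDeriv (b k) p) / eval (T • (1 : ι → ℝ)) p < 1 :=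
    (div_lt_one (hpos T le_rfl)).2 hk
  have h2 := (div_lt_one (hpos s hs)).1 (hanti.trans_lt h1)
  rw [map_sub]
  exact sub_pos.2 h2

/-- Iterated choice of directions. -/
theorem Stable.exists_applyOps_pos [Fintype ι] {κ : Type*} {N r : ℕ} (hr : 0 < r)
    {b : κ → Fin r → ι → ℝ} (hb : ∀ i k, 0 ≤ b i k) {c : κ → ι → ℝ} (hc : ∀ i, 0 ≤ c i)
    (hbc : ∀ i, (r : ℝ) • c i = ∑ k, b i k) {T : ℝ} {l : List κ} (hl : l.Nodup)
    {p : MvPolynomial ι ℝ} (hp : Stable p) (hN : DiagMonic N p)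
    (h : ∀ s, T ≤ s → 0 < eval (s • (1 : ι → ℝ)) (RealStable.applyOps (l.map c) p)) :
    ∃ σ : κ → Fin r, ∀ s, T ≤ s →
      0 < eval (s • (1 : ι → ℝ)) (RealStable.applyOps (l.map fun i => b i (σ i)) p) := by
  classical
  induction l generalizing p with
  | nil => exact ⟨fun _ => ⟨0, hr⟩, h⟩
  | cons i l ih =>
    obtain ⟨hi, hl⟩ := List.nodup_cons.1 hl
    have hlc : ∀ d ∈ l.map c, 0 ≤ d := by
      intro d hd
      obtain ⟨j, -, rfl⟩ := List.mem_map.1 hd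
      exact hc j
    rw [List.map_cons] at h
    simp only [applyOps_cons, applyOps_sub_dirDeriv] at h
    -- The operator of index `i` is commuted to the end, exchanged there, and commuted back before
    -- the induction continues.
    obtain ⟨k, hk⟩ := (Stable.applyOps hlc hp).exists_sub_dirDeriv_pos
      (hN.applyOps _).eventually_pos hr (hb i) (hc i) (hbc i) h
    simp only [← applyOps_sub_dirDeriv] at hk
    obtain ⟨σ, hσ⟩ := ih hl (hp.sub_dirDeriv (hb i k)) (hN.sub_dirDeriv _) hk
    refine ⟨Function.update σ i k, fun s hs => ?_⟩
    have hmap : l.map (fun j => b j (Function.update σ i k j)) = l.map fun j => b j (σ j) := by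
      refine List.map_congr_left fun j hj => ?_
      rw [Function.update_of_ne (by rintro rfl; exact hi hj)]
    rw [List.map_cons, hmap, Function.update_self, applyOps_cons]
    exact hσ s hs

end stability

open MvPolynomial ComplexConjugate ComplexOrder

/-! ### Operators acting as translations -/

section affine

variable {ι : Type*}

/-- If `p` is affine in the direction `b`, then `1 - D_b` acts on `p` as a translation. -/
theorem eval_sub_dirDeriv_of_affine {p : MvPolynomial ι ℝ} {x b : ι → ℝ}
    (h : ∃ α β : ℝ, ∀ t : ℝ, eval (x + t • b) p = α + t * β) :
    eval x (p - dirDeriv b p) = eval (x - b) p := by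
  obtain ⟨α, β, h⟩ := h
  have hline : restrictLine x b p = Polynomial.C α + Polynomial.C β * Polynomial.X := by
    refine Polynomial.funext fun t => ?_
    rw [eval_restrictLine_real, h, Polynomial.eval_add, Polynomial.eval_mul, Polynomial.eval_C,
      Polynomial.eval_C, Polynomial.eval_X, mul_comm t]
  have hd : eval x (dirDeriv b p) = β := by
    have h1 := eval_restrictLine_real x b (dirDeriv b p) 0
    rw [← derivative_restrictLine, hline] at h1
    simpa using h1.symm
  have h0 := h 0
  have h1 := h (-1)
  rw [zero_smul, add_zero, zero_mul, add_zero] at h0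
  rw [neg_one_smul, ← sub_eq_add_neg] at h1
  rw [map_sub, hd, h0, h1]
  ring

/-- A translate of `p` is still affine in the remaining directions, so the translations compose. -/
theorem eval_applyOps_of_affine {l : List (ι → ℝ)} {p : MvPolynomial ι ℝ}
    (h : ∀ b ∈ l, ∀ x, ∃ α β : ℝ, ∀ t : ℝ, eval (x + t • b) p = α + t * β) (x : ι → ℝ) :
    eval x (applyOps l p) = eval (x - l.sum) p := by
  induction l generalizing p with
  | nil => simp [applyOps]
  | cons c l ih =>
    have hc : ∀ x, eval x (p - dirDeriv c p) = eval (x - c) p := fun x =>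
      eval_sub_dirDeriv_of_affine (h c List.mem_cons_self x)
    rw [applyOps_cons, ih, hc, List.sum_cons]
    · congr 2
      abel
    · intro b hb x
      obtain ⟨α, β, hαβ⟩ := h b (List.mem_cons_of_mem _ hb) (x - c)
      refine ⟨α, β, fun t => ?_⟩
      rw [hc, ← hαβ]
      congr 2
      abel

end affine

/-! ### Determinants of Hermitian pencils -/

section det

variable {n κ ω : Type*} [Fintype n] [DecidableEq n] [Fintype κ] [Fintype ω]

/-- The product over `k` of the determinants of the pencils `∑ i, w (i, k) • E i` of Hermitian
matrices is a real polynomial in `w`. -/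
theorem exists_detPolynomial {E : κ → Matrix n n ℂ} (hE : ∀ i, (E i).IsHermitian) :
    ∃ P : MvPolynomial (κ × ω) ℝ, P.totalDegree ≤ Fintype.card ω * Fintype.card n ∧
      ∀ w : κ × ω → ℂ, aeval w P = ∏ k, (∑ i, w (i, k) • E i).det := by
  let M : ω → Matrix n n (MvPolynomial (κ × ω) ℂ) := fun k =>
    Matrix.of fun a b => ∑ i, C (E i a b) * X (i, k)
  let Q : MvPolynomial (κ × ω) ℂ := ∏ k, (M k).det
  -- Conjugating the coefficients transposes each Hermitian pencil and leaves its determinant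
  -- unchanged.
  have hconj : map (starRingEnd ℂ) Q = Q := by
    simp only [Q, map_prod]
    refine Finset.prod_congr rfl fun k _ => ?_
    rw [RingHom.map_det, ← Matrix.det_transpose]
    congr 1
    ext1 a b
    simp only [M, Matrix.transpose_apply, RingHom.mapMatrix_apply, Matrix.map_apply,
      Matrix.of_apply, map_sum, map_mul, map_C, map_X]
    refine Finset.sum_congr rfl fun i _ => ?_
    rw [starRingEnd_apply, (hE i).apply]
  have hrange : Q ∈ Set.range (map (algebraMap ℝ ℂ)) := by
    rw [mem_range_map_iff_coeffs_subset]
    intro z hz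
    obtain ⟨s, -, rfl⟩ := mem_coeffs_iff.1 hz
    have h1 := congrArg (coeff s) hconj
    rw [coeff_map] at h1
    exact ⟨(coeff s Q).re, Complex.conj_eq_iff_re.1 h1⟩
  obtain ⟨P, hP⟩ := hrange
  refine ⟨P, ?_, fun w => ?_⟩
  · have h1 : P.totalDegree = Q.totalDegree := by
      rw [totalDegree, totalDegree, ← hP,
        support_map_of_injective _ (algebraMap ℝ ℂ).injective]
    have h2 : ∀ k, (M k).det.totalDegree ≤ Fintype.card n := by
      intro k
      rw [Matrix.det_apply]
      refine totalDegree_finsetSum_le fun σ _ => ?_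
      rw [Units.smul_def, zsmul_eq_mul, ← map_intCast (C (σ := κ × ω) (R := ℂ))]
      refine (totalDegree_mul _ _).trans ?_
      rw [totalDegree_C, zero_add]
      refine (totalDegree_finsetProd _ _).trans ?_
      refine (Finset.sum_le_card_nsmul _ _ 1 fun a _ => ?_).trans (by simp)
      refine totalDegree_finsetSum_le fun i _ => ?_
      refine (totalDegree_mul _ _).trans ?_
      simp
    rw [h1]
    refine (totalDegree_finsetProd _ _).trans ?_
    refine (Finset.sum_le_card_nsmul _ _ _ fun k _ => h2 k).trans ?_
    simp
  · have h1 : aeval w P = eval w Q := by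
      rw [← hP, eval_map, aeval_def]
    rw [h1, map_prod]
    refine Finset.prod_congr rfl fun k _ => ?_
    rw [RingHom.map_det]
    congr 1
    ext1 a b
    simp [M, Matrix.sum_apply, mul_comm]

/-- The determinant is affine along rank-one perturbations. -/
theorem exists_det_add_smul_vecMulVec (A : Matrix n n ℂ) (a b : n → ℂ) :
    ∃ β, ∀ t : ℂ, (A + t • Matrix.vecMulVec a b).det = A.det + t * β := by
  -- By the Schur complement, the determinant equals that of a bordered matrix in which `t` enters
  -- only the first row, affinely.
  let N : Matrix (Unit ⊕ n) (Unit ⊕ n) ℂ :=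
    Matrix.fromBlocks 1 0 (Matrix.replicateCol Unit a) A
  let e : Unit ⊕ n → ℂ := Sum.elim 1 0
  let f : Unit ⊕ n → ℂ := Sum.elim 0 (-b)
  have hdet : ∀ t : ℂ, (A + t • Matrix.vecMulVec a b).det =
      (N.updateRow (Sum.inl ()) (e + t • f)).det := by
    intro t
    have h1 := Matrix.det_fromBlocks_one₁₁ (Matrix.replicateRow Unit (-(t • b)))
      (Matrix.replicateCol Unit a) A
    have h2 : A - Matrix.replicateCol Unit a * Matrix.replicateRow Unit (-(t • b)) =
        A + t • Matrix.vecMulVec a b := by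
      rw [← Matrix.vecMulVec_eq]
      ext i j
      simp [Matrix.vecMulVec_apply]
    rw [← h2, ← h1]
    congr 1
    ext i j
    rcases i with i | i <;> rcases j with j | j <;>
      simp [N, e, f, Matrix.updateRow_apply]
  refine ⟨(N.updateRow (Sum.inl ()) f).det, fun t => ?_⟩
  have h0 := hdet 0
  rw [zero_smul, zero_smul, add_zero, add_zero] at h0
  rw [hdet, Matrix.det_updateRow_add, Matrix.det_updateRow_smul, h0]

end det

/-- A Hermitian matrix `H` such that no `s • 1 + H` with `s ≥ 0` is singular is positive
semidefinite. -/
theorem posSemidef_of_det_ne_zero {n : Type*} [Fintype n] [DecidableEq n] {H : Matrix n n ℂ}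
    (hH : H.IsHermitian) (h : ∀ s : ℝ, 0 ≤ s → ((s : ℂ) • (1 : Matrix n n ℂ) + H).det ≠ 0) :
    H.PosSemidef := by
  rw [hH.posSemidef_iff_eigenvalues_nonneg]
  intro j
  by_contra hj
  have hj : hH.eigenvalues j < 0 := not_le.1 hj
  refine h (-hH.eigenvalues j) (by linarith) (Matrix.exists_mulVec_eq_zero_iff.1
    ⟨(hH.eigenvectorBasis j).ofLp, ?_, ?_⟩)
  · intro h0
    have h1 := hH.eigenvectorBasis.orthonormal.ne_zero j
    exact h1 (by ext a; exact congrFun h0 a)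
  · rw [Matrix.add_mulVec, Matrix.smul_mulVec, Matrix.one_mulVec, hH.mulVec_eigenvectorBasis]
    ext a
    simp

/-! ### The pencil of a Parseval frame and the partition -/

variable {n κ : Type*} [Fintype n] [Fintype κ]

/-- The quadratic form of the pencil `∑ i, w i • v i (v i)ᴴ`. -/
theorem star_dotProduct_pencil_mulVec (v : κ → n → ℂ) (w : κ → ℂ) (x : n → ℂ) :
    star x ⬝ᵥ (∑ i, w i • Matrix.vecMulVec (v i) (star (v i))).mulVec x =
      ∑ i, w i * ((‖star (v i) ⬝ᵥ x‖ ^ 2 : ℝ) : ℂ) := by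
  rw [Matrix.sum_mulVec, dotProduct_sum]
  refine Finset.sum_congr rfl fun i _ => ?_
  have h : star x ⬝ᵥ v i = conj (star (v i) ⬝ᵥ x) := by
    rw [starRingEnd_apply, Matrix.star_dotProduct]
  rw [Matrix.smul_mulVec, dotProduct_smul, Matrix.vecMulVec_mulVec, op_smul_eq_smul,
    dotProduct_smul, h, smul_eq_mul, smul_eq_mul, Complex.mul_conj, Complex.normSq_eq_norm_sq]

theorem isHermitian_vecMulVec_star (v : n → ℂ) : (Matrix.vecMulVec v (star v)).IsHermitian :=
  (Matrix.posSemidef_vecMulVec_self_star v).1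

theorem star_dotProduct_self_eq (x : n → ℂ) :
    star x ⬝ᵥ x = ((∑ j, ‖x j‖ ^ 2 : ℝ) : ℂ) := by
  rw [dotProduct, Complex.ofReal_sum]
  refine Finset.sum_congr rfl fun j _ => ?_
  rw [Pi.star_apply, mul_comm, ← starRingEnd_apply, Complex.mul_conj, Complex.normSq_eq_norm_sq]

/-- The rank-one matrices of a Parseval frame sum to the identity. -/
theorem sum_vecMulVec_eq_one [DecidableEq n] {v : κ → n → ℂ}
    (hv : ∀ x : n → ℂ, ∑ i, ‖star (v i) ⬝ᵥ x‖ ^ 2 = ∑ j, ‖x j‖ ^ 2) :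
    ∑ i, Matrix.vecMulVec (v i) (star (v i)) = 1 := by
  set S := ∑ i, Matrix.vecMulVec (v i) (star (v i)) with hS
  have hq : ∀ x : n → ℂ, star x ⬝ᵥ S.mulVec x = star x ⬝ᵥ x := by
    intro x
    have h1 := star_dotProduct_pencil_mulVec v 1 x
    simp only [Pi.one_apply, one_smul, one_mul] at h1
    rw [hS, h1, ← Complex.ofReal_sum, hv x, star_dotProduct_self_eq]
  have h0 : Matrix.toEuclideanLin (S - 1) = 0 := by
    rw [← inner_map_self_eq_zero]
    intro x
    rw [← inner_conj_symm, EuclideanSpace.inner_eq_star_dotProduct, Matrix.ofLp_toLpLin,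
      Matrix.toLin'_apply, dotProduct_comm, Matrix.sub_mulVec, Matrix.one_mulVec,
      dotProduct_sub, hq, sub_self, map_zero]
  rw [LinearEquiv.map_eq_zero_iff] at h0
  exact sub_eq_zero.1 h0

/-- For a Parseval frame `v` with `‖v i‖ ^ 2 ≤ δ`, the index set splits into `r` parts, each
of which is, after scaling by `√r`, a Bessel sequence with bound `(1 + √(r δ)) ^ 2`. -/
theorem exists_partition [DecidableEq n] [DecidableEq κ] {v : κ → n → ℂ}
    (hv : ∀ x : n → ℂ, ∑ i, ‖star (v i) ⬝ᵥ x‖ ^ 2 = ∑ j, ‖x j‖ ^ 2) {δ : ℝ} (hδ : 0 < δ)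
    (hnorm : ∀ i, ∑ j, ‖v i j‖ ^ 2 ≤ δ) {r : ℕ} (hr : 0 < r) :
    ∃ σ : κ → Fin r, ∀ k, ∀ x : n → ℂ,
      r * ∑ i with σ i = k, ‖star (v i) ⬝ᵥ x‖ ^ 2 ≤ (1 + √(r * δ)) ^ 2 * ∑ j, ‖x j‖ ^ 2 := by
  have hr0 : (0 : ℝ) < r := by exact_mod_cast hr
  set E : κ → Matrix n n ℂ := fun i => Matrix.vecMulVec (v i) (star (v i)) with hE
  have hEh : ∀ i, (E i).IsHermitian := fun i => isHermitian_vecMulVec_star (v i)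
  have hE1 : ∑ i, E i = 1 := sum_vecMulVec_eq_one hv
  have hpos_of_ne : ∀ x : n → ℂ, x ≠ 0 → ∃ i, 0 < ‖star (v i) ⬝ᵥ x‖ ^ 2 := by
    intro x hx
    by_contra! hall
    have h1 : ∑ j, ‖x j‖ ^ 2 ≤ 0 := by
      rw [← hv x]
      exact Finset.sum_nonpos fun i _ => hall i
    obtain ⟨j, hj⟩ := Function.ne_iff.1 hx
    have h2 : 0 < ∑ j, ‖x j‖ ^ 2 := Finset.sum_pos' (fun _ _ => by positivity)
      ⟨j, Finset.mem_univ _, by have := norm_pos_iff.2 hj; positivity⟩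
    linarith
  obtain ⟨P, hdeg, hP⟩ := exists_detPolynomial (ω := Fin r) hEh
  have hPreal : ∀ y : κ × Fin r → ℝ,
      ((eval y P : ℝ) : ℂ) = ∏ k, (∑ i, (y (i, k) : ℂ) • E i).det := by
    intro y
    rw [← hP fun a => (y a : ℂ)]
    have := aeval_algebraMap_apply ℂ y P
    rw [aeval_eq_eval] at this
    exact this.symm
  have hstable : Stable P := by
    intro w hw
    rw [hP, Finset.prod_ne_zero_iff]
    intro k _ hdet
    obtain ⟨x, hx, hx0⟩ := Matrix.exists_mulVec_eq_zero_iff.2 hdet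
    -- For a kernel vector `x` the quadratic form is zero, yet its imaginary part is `∑ Im w (i, k)
    -- |⟨v i, x⟩|² > 0`.
    have h1 := star_dotProduct_pencil_mulVec v (fun i => w (i, k)) x
    rw [hx0, dotProduct_zero] at h1
    have h2 := congrArg Complex.im h1
    simp only [Complex.zero_im, Complex.im_sum, Complex.im_mul_ofReal] at h2
    obtain ⟨i, hi⟩ := hpos_of_ne x hx
    have h3 : 0 < ∑ i, (w (i, k)).im * ‖star (v i) ⬝ᵥ x‖ ^ 2 :=
      Finset.sum_pos' (fun j _ => mul_nonneg (hw _).le (by positivity))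
        ⟨i, Finset.mem_univ _, mul_pos (hw _) hi⟩
    linarith
  have habove : ∀ t : ℝ, 0 < t → Above P (t • 1) := by
    intro t ht y hy
    have h1 : (0 : ℂ) < ((eval y P : ℝ) : ℂ) := by
      rw [hPreal]
      refine Finset.prod_pos fun k _ => Matrix.PosDef.det_pos ?_
      refine Matrix.PosDef.of_dotProduct_mulVec_pos ?_ fun x hx => ?_
      · rw [Matrix.IsHermitian, Matrix.conjTranspose_sum]
        refine Finset.sum_congr rfl fun i _ => ?_
        rw [Matrix.conjTranspose_smul, (hEh i).eq]
        simp
      · rw [star_dotProduct_pencil_mulVec]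
        have hy' : ∀ i, 0 < y (i, k) := fun i => ht.trans_le (by simpa using hy (i, k))
        obtain ⟨i, hi⟩ := hpos_of_ne x hx
        have h3 : 0 < ∑ i, y (i, k) * ‖star (v i) ⬝ᵥ x‖ ^ 2 :=
          Finset.sum_pos' (fun j _ => mul_nonneg (hy' _).le (by positivity))
            ⟨i, Finset.mem_univ _, mul_pos (hy' _) hi⟩
        exact_mod_cast h3
    exact_mod_cast h1
  set N := Fintype.card (Fin r) * Fintype.card n with hN
  have hdiag : ∀ s : ℝ, eval (s • (1 : κ × Fin r → ℝ)) P = s ^ N := by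
    intro s
    have h1 := hPreal (s • 1)
    simp only [Pi.smul_apply, Pi.one_apply, smul_eq_mul, mul_one, ← Finset.smul_sum, hE1,
      Matrix.det_smul, Matrix.det_one, Finset.prod_const, Finset.card_univ, ← pow_mul] at h1
    rw [hN, mul_comm]
    exact_mod_cast h1
  have hmonic : DiagMonic N P := by
    refine ⟨hdeg, ?_⟩
    have : restrictLine (0 : κ × Fin r → ℝ) 1 P = Polynomial.X ^ N :=
      Polynomial.funext fun s => by rw [eval_restrictLine_diag, hdiag]; simp
    rw [this, Polynomial.coeff_X_pow_self]
  let c : κ → κ × Fin r → ℝ := fun i a => if a.1 = i then 1 else 0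
  let b : κ → Fin r → κ × Fin r → ℝ := fun i k => Pi.single (i, k) (r : ℝ)
  have hc : ∀ i, 0 ≤ c i := by
    intro i a
    simp only [c, Pi.zero_apply]
    split_ifs <;> norm_num
  have hb : ∀ i k, 0 ≤ b i k := fun i k => Pi.single_nonneg.2 hr0.le
  have hbc : ∀ i, (r : ℝ) • c i = ∑ k, b i k := by
    intro i
    ext ⟨j, k⟩
    simp only [c, b, Pi.smul_apply, smul_eq_mul, mul_ite, mul_one, mul_zero, Finset.sum_apply,
      Pi.single_apply, Prod.mk.injEq]
    by_cases hji : j = i <;> simp [hji]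
  have hcsum : ∑ i, c i = 1 := by
    ext a
    simp [c]
  have hΦ : ∀ i, ∀ t : ℝ, 0 < t → eval (t • (1 : κ × Fin r → ℝ)) (dirDeriv (c i) P) ≤
      (r * δ / t) * eval (t • (1 : κ × Fin r → ℝ)) P := by
    intro i t ht
    set a : ℝ := ∑ j, ‖v i j‖ ^ 2 with ha
    have hai : star (v i) ⬝ᵥ v i = (a : ℂ) := star_dotProduct_self_eq (v i)
    have haδ : a ≤ δ := hnorm i
    -- Each of the `r` factors is `det (t + s E i) = t ^ card n * (1 + s a / t)`, so the barrier
    -- value at `t • 1` is `r a / t`.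
    have hline : restrictLine (t • (1 : κ × Fin r → ℝ)) (c i) P =
        (Polynomial.C (t ^ Fintype.card n) * (1 + Polynomial.C (a / t) * Polynomial.X)) ^ r := by
      refine Polynomial.funext fun s => ?_
      rw [eval_restrictLine_real]
      have h1 := hPreal (t • 1 + s • c i)
      have h2 : ∀ k : Fin r, (∑ j, (((t • (1 : κ × Fin r → ℝ) + s • c i) (j, k) : ℝ) : ℂ) • E j).det
          = ((t ^ Fintype.card n * (1 + a / t * s) : ℝ) : ℂ) := by
        intro k
        have ht' : (t : ℂ) ≠ 0 := by exact_mod_cast ht.ne'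
        have h3 : ∑ j, (((t • (1 : κ × Fin r → ℝ) + s • c i) (j, k) : ℝ) : ℂ) • E j =
            (t : ℂ) • (1 + Matrix.replicateCol Unit ((s / t : ℂ) • v i) *
              Matrix.replicateRow Unit (star (v i))) := by
          rw [← Matrix.vecMulVec_eq, Matrix.smul_vecMulVec, smul_add, smul_smul,
            mul_div_cancel₀ _ ht', ← hE1, Finset.smul_sum]
          simp only [Pi.add_apply, Pi.smul_apply, Pi.one_apply, smul_eq_mul, mul_one, c,
            Complex.ofReal_add, add_smul, Finset.sum_add_distrib]
          congr 1
          simp [E]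
        rw [h3, Matrix.det_smul, Matrix.det_one_add_replicateCol_mul_replicateRow, dotProduct_smul,
          hai]
        push_cast
        simp only [smul_eq_mul]
        ring
      simp only [h2, Finset.prod_const, Finset.card_univ, Fintype.card_fin] at h1
      simp only [Polynomial.eval_pow, Polynomial.eval_mul, Polynomial.eval_C, Polynomial.eval_add,
        Polynomial.eval_one, Polynomial.eval_X]
      exact_mod_cast h1
    have h1 := eval_restrictLine_real (t • (1 : κ × Fin r → ℝ)) (c i) (dirDeriv (c i) P) 0
    have h2 := eval_restrictLine_real (t • (1 : κ × Fin r → ℝ)) (c i) P 0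
    rw [zero_smul, add_zero] at h1 h2
    rw [← derivative_restrictLine] at h1
    rw [← h1, ← h2, hline]
    simp only [Polynomial.derivative_pow, Polynomial.eval_pow, Polynomial.eval_mul,
      Polynomial.eval_C, Polynomial.eval_add, Polynomial.eval_one, Polynomial.eval_X,
      Polynomial.derivative_mul, Polynomial.derivative_C, Polynomial.derivative_add,
      Polynomial.derivative_one, Polynomial.derivative_X, mul_zero, add_zero, zero_mul, zero_add,
      mul_one]
    obtain ⟨r', rfl⟩ : ∃ r', r = r' + 1 := ⟨r - 1, by omega⟩
    rw [Nat.add_sub_cancel]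
    calc ((r' + 1 : ℕ) : ℝ) * (t ^ Fintype.card n) ^ r' * (t ^ Fintype.card n * (a / t))
        = (((r' + 1 : ℕ) : ℝ) * a / t) * (t ^ Fintype.card n) ^ (r' + 1) := by ring
      _ ≤ _ := by gcongr
  set ε : ℝ := √(r * δ) with hε
  have hε0 : 0 < ε := Real.sqrt_pos.2 (by positivity)
  have hεsq : r * δ = ε ^ 2 := (Real.sq_sqrt (by positivity)).symm
  -- At `t = ε + ε²` the barrier is at most `ε² / t = 1 - 1 / (1 + ε)`, exactly what a step of
  -- length `1 + ε` allows. As `∑ c i = 1`, the steps end at `(t + 1 + ε) • 1 = (1 + ε)² • 1`.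
  have habove' := above_applyOps (l := Finset.univ.toList.map c) (p := P) (x := (ε + ε ^ 2) • 1)
    (δ := 1 + ε) (fun d hd => by
      obtain ⟨i, -, rfl⟩ := List.mem_map.1 hd
      exact hc i) hstable (habove _ (by positivity)) (by positivity) (fun d hd => by
      obtain ⟨i, -, rfl⟩ := List.mem_map.1 hd
      have h1 := hΦ i (ε + ε ^ 2) (by positivity)
      have h2 : r * δ / (ε + ε ^ 2) = 1 - 1 / (1 + ε) := by
        rw [hεsq]
        field_simp
        ring
      rwa [h2] at h1)
  rw [Finset.sum_map_toList, hcsum, ← add_smul] at habove'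
  have hT : ε + ε ^ 2 + (1 + ε) = (1 + ε) ^ 2 := by ring
  rw [hT] at habove'
  obtain ⟨σ, hσ⟩ := Stable.exists_applyOps_pos hr hb hc hbc (T := (1 + ε) ^ 2)
    (Finset.nodup_toList Finset.univ) hstable hmonic fun s hs =>
      habove' _ (smul_le_smul_of_nonneg_right hs zero_le_one)
  have haffine : ∀ i k, ∀ x : κ × Fin r → ℝ, ∃ α β : ℝ, ∀ t : ℝ,
      eval (x + t • b i k) P = α + t * β := by
    intro i k x
    obtain ⟨β, hβ⟩ := exists_det_add_smul_vecMulVec (∑ j, (x (j, k) : ℂ) • E j) (v i) (star (v i))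
    set R : ℂ := ∏ l ∈ Finset.univ.erase k, (∑ j, (x (j, l) : ℂ) • E j).det with hR
    set A : ℂ := (∑ j, (x (j, k) : ℂ) • E j).det with hA
    refine ⟨(A * R).re, (r * β * R).re, fun t => ?_⟩
    have h1 := hPreal (x + t • b i k)
    rw [← Finset.mul_prod_erase _ _ (Finset.mem_univ k)] at h1
    have h2 : ∏ l ∈ Finset.univ.erase k,
        (∑ j, (((x + t • b i k) (j, l) : ℝ) : ℂ) • E j).det = R := by
      refine Finset.prod_congr rfl fun l hl => ?_
      have hlk : l ≠ k := Finset.ne_of_mem_erase hl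
      congr 1
      refine Finset.sum_congr rfl fun j _ => ?_
      simp [b, hlk]
    have h3 : ∑ j, (((x + t • b i k) (j, k) : ℝ) : ℂ) • E j =
        ∑ j, (x (j, k) : ℂ) • E j + ((t : ℂ) * r) • E i := by
      simp only [Pi.add_apply, Pi.smul_apply, smul_eq_mul, Complex.ofReal_add, add_smul,
        Finset.sum_add_distrib]
      congr 1
      rw [Finset.sum_eq_single i]
      · simp [b]
      · intro j _ hj
        simp [b, hj]
      · simp
    rw [h2, h3, hβ] at h1
    have h4 : (A + ((t : ℂ) * r) * β) * R = A * R + (t : ℂ) * (r * β * R) := by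
      ring
    rw [h4] at h1
    have h5 := congrArg Complex.re h1
    rwa [Complex.ofReal_re, Complex.add_re, Complex.re_ofReal_mul] at h5
  refine ⟨σ, fun k x => ?_⟩
  -- `B` is `(1 + ε)² - r ∑_{σ i = k} E i`; its positive semidefiniteness is the claimed bound.
  set B : Matrix n n ℂ := ∑ i, ((((1 + ε) ^ 2 - if σ i = k then (r : ℝ) else 0) : ℝ) : ℂ) • E i
    with hB
  have hBh : B.IsHermitian := by
    rw [Matrix.IsHermitian, hB, Matrix.conjTranspose_sum]
    refine Finset.sum_congr rfl fun i _ => ?_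
    rw [Matrix.conjTranspose_smul, (hEh i).eq, ← starRingEnd_apply, Complex.conj_ofReal]
  have hBpsd : B.PosSemidef := by
    refine posSemidef_of_det_ne_zero hBh fun s hs => ?_
    have h1 := hσ ((1 + ε) ^ 2 + s) (by linarith)
    rw [eval_applyOps_of_affine (fun d hd => by
      obtain ⟨i, -, rfl⟩ := List.mem_map.1 hd
      exact haffine i (σ i)), Finset.sum_map_toList] at h1
    have h2 : ∏ l, (∑ i, (((((1 + ε) ^ 2 + s) • (1 : κ × Fin r → ℝ) - ∑ j, b j (σ j)) (i, l) : ℝ) : ℂ)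
        • E i).det ≠ 0 := by
      rw [← hPreal]
      exact_mod_cast h1.ne'
    have h3 := Finset.prod_ne_zero_iff.1 h2 k (Finset.mem_univ k)
    have h4 : (s : ℂ) • (1 : Matrix n n ℂ) + B =
        ∑ i, (((((1 + ε) ^ 2 + s) • (1 : κ × Fin r → ℝ) - ∑ j, b j (σ j)) (i, k) : ℝ) : ℂ) • E i := by
      rw [hB, ← hE1, Finset.smul_sum, ← Finset.sum_add_distrib]
      refine Finset.sum_congr rfl fun i _ => ?_
      rw [← add_smul, ← Complex.ofReal_add]
      congr 2
      have h5 : (∑ j, b j (σ j)) (i, k) = if σ i = k then (r : ℝ) else 0 := by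
        rw [Finset.sum_apply, Finset.sum_eq_single i]
        · simp [b, Pi.single_apply, eq_comm]
        · intro j _ hji
          simp [b, hji.symm]
        · simp
      rw [Pi.sub_apply, h5, Pi.smul_apply, Pi.one_apply, smul_eq_mul]
      ring
    rwa [h4]
  have h1 := hBpsd.dotProduct_mulVec_nonneg x
  rw [hB, star_dotProduct_pencil_mulVec] at h1
  have h2 : 0 ≤ ∑ i, ((1 + ε) ^ 2 - if σ i = k then (r : ℝ) else 0) * ‖star (v i) ⬝ᵥ x‖ ^ 2 := by
    exact_mod_cast h1
  simp only [sub_mul, Finset.sum_sub_distrib, ← Finset.mul_sum, hv x, ite_mul, zero_mul] at h2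
  rw [← Finset.sum_filter, ← Finset.mul_sum] at h2
  linarith

end RealStable

theorem mainTheorem4 (m d : ℕ) (u : Fin m → EuclideanSpace ℂ (Fin d)) (δ : ℝ) (hδ : 0 ≤ δ)
    (hu : IsParsevalFrame u) (hnorm : ∀ i, ‖u i‖ ^ 2 ≤ δ) (r : ℕ) (hr : 0 < r) :
    ∃ I : Fin r → Finset (Fin m), IsIndexPartition I ∧
      ∀ k, IsBesselSequence (fun i : I k => u i) ((1 / √(r : ℝ) + √δ) ^ 2) := by
  have hinner : ∀ i x, star (u i).ofLp ⬝ᵥ x.ofLp = inner ℂ (u i) x := fun i x => by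
    rw [EuclideanSpace.inner_eq_star_dotProduct, dotProduct_comm]
  obtain ⟨σ, hσ⟩ : ∃ σ : Fin m → Fin r, ∀ k, ∀ x : EuclideanSpace ℂ (Fin d),
      r * ∑ i with σ i = k, ‖inner ℂ (u i) x‖ ^ 2 ≤ (1 + √(r * δ)) ^ 2 * ‖x‖ ^ 2 := by
    -- For `δ = 0` all vectors vanish and any partition works; the barrier argument needs `ε > 0` to
    -- start from a positive point.
    rcases hδ.eq_or_lt with rfl | hδ
    · refine ⟨fun _ => ⟨0, hr⟩, fun k x => ?_⟩
      have h0 : ∀ i, u i = 0 := fun i => by simpa using hnorm i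
      simp only [h0, inner_zero_left, norm_zero]
      simp
    · obtain ⟨σ, hσ⟩ := RealStable.exists_partition (v := fun i => (u i).ofLp) (fun x => by
        obtain ⟨-, -, h1, h2⟩ := hu
        have h3 := (h1 (WithLp.toLp 2 x)).2
        have h4 := h2 (WithLp.toLp 2 x)
        rw [tsum_fintype, one_mul, EuclideanSpace.norm_sq_eq] at h3 h4
        simpa only [← hinner] using le_antisymm h3 h4) hδ (fun i => by
        rw [← EuclideanSpace.norm_sq_eq]
        exact hnorm i) hr
      refine ⟨σ, fun k x => ?_⟩
      simpa only [hinner, ← EuclideanSpace.norm_sq_eq] using hσ k x.ofLp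
  refine ⟨fun k => {i | σ i = k}, ⟨?_, fun i => ⟨σ i, by simp⟩⟩, fun k x => ⟨Summable.of_finite, ?_⟩⟩
  · intro j k hjk
    rw [Finset.disjoint_left]
    intro i hi hi'
    simp only [Finset.mem_filter] at hi hi'
    exact hjk (hi.2.symm.trans hi'.2)
  · rw [tsum_fintype, Finset.sum_coe_sort _ fun i => ‖inner ℂ (u i) x‖ ^ 2]
    have hr0 : (0 : ℝ) < r := by exact_mod_cast hr
    have hsq : (0 : ℝ) < √r := Real.sqrt_pos.2 hr0
    have h1 : (1 + √(r * δ)) ^ 2 = r * (1 / √(r : ℝ) + √δ) ^ 2 := by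
      rw [Real.sqrt_mul hr0.le]
      nth_rw 2 [← Real.sq_sqrt hr0.le]
      field_simp
    have h2 := hσ k x
    rw [h1, mul_assoc] at h2
    exact le_of_mul_le_mul_left h2 hr0
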